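/- For an integer $n\ge 0$ let $s(n)$ be the number of $1$s in the binary expansion of $n$. For every integer $t\ge 0$ the limit $$c_t=\lim_{N\to\infty}\frac1N\,\bigl|\{0\le n<N : s(n+t)\ge s(n)\}\bigr|$$ exists, and there is an absolute constant $M_0$ with the following property: if the binary expansion of the integer $t\ge 0$ has at least $M_0$ maximal blocks of contiguous $1$s, then $c_t>1/2$. -/

import Mathlib

/-- The binary sum-of-digits function `s`. -/
def binaryDigitSum (n : ℕ) : ℕ := (Nat.digits 2 n).sum

/-- The set `A` of natural numbers has asymptotic density `d`:
`|{0 ≤ n < N : n ∈ A}| / N → d` as `N → ∞`. -/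
def HasAsymptoticDensity (A : Set ℕ) (d : ℝ) : Prop :=
  Filter.Tendsto (fun N : ℕ => (({n : ℕ | n < N ∧ n ∈ A}.ncard : ℕ) : ℝ) / (N : ℝ))
    Filter.atTop (nhds d)

/-- The digits of `t` at the positions `μ, …, μ + ν - 1` (position `0` being the least significant
one) form a maximal block of `1`s in the binary expansion of `t`. -/
def IsMaximalOneBlock (t μ ν : ℕ) : Prop :=
  1 ≤ ν ∧ (∀ i, μ ≤ i → i < μ + ν → t.testBit i = true) ∧
    t.testBit (μ + ν) = false ∧ (μ = 0 ∨ t.testBit (μ - 1) = false)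

/-- There are only finitely many maximal blocks of `1`s, so their number is given by `Set.ncard`. -/
theorem finite_maximalOneBlocks (t : ℕ) :
    {b : ℕ × ℕ | IsMaximalOneBlock t b.1 b.2}.Finite := by
  have key : ∀ i, t.testBit i = true → i ≤ t := fun i hi =>
    (Nat.lt_two_pow_self.trans_le (Nat.ge_two_pow_of_testBit hi)).le
  refine ((Set.finite_Iic t).prod (Set.finite_Iic (t + 1))).subset ?_
  rintro ⟨μ, ν⟩ ⟨h1, h2, -, -⟩
  have ha := key _ (h2 μ le_rfl (by simp at h1; omega))
  have hb := key _ (h2 (μ + ν - 1) (by simp at h1; omega) (by simp at h1; omega))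
  simp only [Set.mem_prod, Set.mem_Iic] at *
  omega

/-- The number of maximal blocks of `1`s in the binary expansion of `t`. -/
noncomputable def numOneBlocks (t : ℕ) : ℕ :=
  {b : ℕ × ℕ | IsMaximalOneBlock t b.1 b.2}.ncard

/-! Let X_t be the limit law of s(n+t) - s(n), with variance A = `digitVar t`. Splitting n by parity
gives X_{2t} = X_t, while X_{2t+1} is X_t + 1 or X_{t+1} - 1 with probability 1/2 each. Densities,
characteristic functions, variances and third cumulants all obey this binary recursion. The
densities exist and equal Fourier integrals (`signedTail`) because both sides satisfy the same
recursion with the same boundary values; no limit measure has to be constructed.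

The reference law is a sum of m copies of G - 1, where G counts the failures before the first
success in fair coin tosses. It is nonnegative exactly when the m-th failure precedes the m-th
success, so with probability 1/2 (`signedTail_geomChar_pow`). A mixture over m and m+1 keeps this
balance and can be given any variance A ≥ 2. Its third cumulant is 3A, whereas that of X_t is 3A - D
with D = `skewDefect t` ≥ 12. This smaller skewness adds a positive amount of order D·A^(-3/2) to
P(X_t ≥ 0) - P(X_t < 0).

The error has to be smaller than that although D is only known to be at least 12. A fourth order
error A·θ^4 in the logarithm of the characteristic function would contribute 1/A, which is too much.
With e = `varStep t`, one recursion step really costs only θ^4·e^(2/3), while D gains 3e/2 and A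
gains 1. Since e^(2/3) ≤ l·e + l^(-2), the error is O(θ^4 (l·D + A/l^2)) for every l > 0
(`norm_logError_le`), and l = A^(3/8) makes it negligible. Away from θ = 0 both characteristic
functions are exponentially small in A (`norm_charFn_le`, `norm_refChar_le`). Finally A is at least
the number of blocks of 1s (`numOneBlocks_le_digitVar`), so many blocks force A to be large. -/

/-! ### Recursion and induction along binary digits -/

/-- The sequence `S` with `S 0 = x₀`, `S 1 = x₁`, `S (2t) = S t` and
`S (2t+1) = f t (S t) (S (t+1))` for `t ≥ 1`. -/
def dyadicRec {α : Type*} (x₀ x₁ : α) (f : ℕ → α → α → α) : ℕ → α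
  | 0 => x₀
  | 1 => x₁
  | n + 2 =>
    if h : n % 2 = 0 then dyadicRec x₀ x₁ f (n / 2 + 1)
    else f (n / 2 + 1) (dyadicRec x₀ x₁ f (n / 2 + 1)) (dyadicRec x₀ x₁ f (n / 2 + 2))
  termination_by n => n
  decreasing_by all_goals omega

section dyadicRec

variable {α : Type*} {x₀ x₁ : α} {f : ℕ → α → α → α}

theorem dyadicRec_zero : dyadicRec x₀ x₁ f 0 = x₀ := by rw [dyadicRec]

theorem dyadicRec_one : dyadicRec x₀ x₁ f 1 = x₁ := by rw [dyadicRec]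

theorem dyadicRec_two_mul (t : ℕ) : dyadicRec x₀ x₁ f (2 * t) = dyadicRec x₀ x₁ f t := by
  rcases t with _ | t
  · rfl
  · rw [show 2 * (t + 1) = 2 * t + 2 by ring, dyadicRec, dif_pos (by omega)]
    congr 1
    omega

/-- If `f` fixes `x₁` at the start, the odd recurrence holds for all `t`. -/
theorem dyadicRec_two_mul_add_one (h : f 0 x₀ x₁ = x₁) (t : ℕ) :
    dyadicRec x₀ x₁ f (2 * t + 1) =
      f t (dyadicRec x₀ x₁ f t) (dyadicRec x₀ x₁ f (t + 1)) := by
  rcases t with _ | t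
  · simp only [mul_zero, zero_add, dyadicRec_zero, dyadicRec_one, h]
  · rw [show 2 * (t + 1) + 1 = (2 * t + 1) + 2 by ring, dyadicRec, dif_neg (by omega),
      show (2 * t + 1) / 2 = t by omega]

end dyadicRec

/-- Induction along `t ↦ 2t` and `(t, t+1) ↦ 2t+1`. -/
theorem dyadic_induction {P : ℕ → Prop} (h0 : P 0) (h1 : P 1) (he : ∀ t, P t → P (2 * t))
    (ho : ∀ t, P t → P (t + 1) → P (2 * t + 1)) (t : ℕ) : P t := by
  induction t using Nat.strong_induction_on with
  | _ t ih =>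
    rcases Nat.lt_or_ge t 2 with h | h
    · interval_cases t <;> assumption
    · rcases Nat.even_or_odd' t with ⟨s, rfl | rfl⟩
      · exact he s (ih s (by omega))
      · exact ho s (ih s (by omega)) (ih (s + 1) (by omega))

/-- Induction along the binary digits. -/
theorem digit_induction {P : ℕ → Prop} (h0 : P 0) (he : ∀ t, P t → P (2 * t))
    (ho : ∀ t, P t → P (2 * t + 1)) (t : ℕ) : P t := by
  induction t using Nat.strong_induction_on with
  | _ t ih =>
    rcases Nat.eq_zero_or_pos t with rfl | h
    · exact h0
    · rcases Nat.even_or_odd' t with ⟨s, rfl | rfl⟩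
      · exact he s (ih s (by omega))
      · exact ho s (ih s (by omega))

/-! ### Variance and third cumulant -/

/-- The variance of `s(n+t) - s(n)`. -/
noncomputable def digitVar : ℕ → ℝ := dyadicRec 0 2 (fun _ x y => (x + y) / 2 + 1)

theorem digitVar_zero : digitVar 0 = 0 := dyadicRec_zero

theorem digitVar_one : digitVar 1 = 2 := dyadicRec_one

theorem digitVar_two_mul (t : ℕ) : digitVar (2 * t) = digitVar t := dyadicRec_two_mul t

theorem digitVar_two_mul_add_one (t : ℕ) :
    digitVar (2 * t + 1) = (digitVar t + digitVar (t + 1)) / 2 + 1 :=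
  dyadicRec_two_mul_add_one (f := fun _ x y => (x + y) / 2 + 1) (by norm_num) t

/-- The increment of the variance, normalized to vanish in the limit of many trailing `1`s. -/
noncomputable def varStep (t : ℕ) : ℝ := 2 + digitVar (t + 1) - digitVar t

theorem varStep_zero : varStep 0 = 4 := by
  rw [varStep, zero_add, digitVar_zero, digitVar_one]; norm_num

theorem varStep_two_mul (t : ℕ) : varStep (2 * t) = varStep t / 2 + 2 := by
  rw [varStep, varStep, digitVar_two_mul, digitVar_two_mul_add_one]; ring

theorem varStep_two_mul_add_one (t : ℕ) : varStep (2 * t + 1) = varStep t / 2 := by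
  rw [varStep, varStep, show 2 * t + 1 + 1 = 2 * (t + 1) by ring, digitVar_two_mul,
    digitVar_two_mul_add_one]; ring

/-- Both digit maps e ↦ e/2 + 2 and e ↦ e/2 preserve the interval (0, 4]. -/
theorem varStep_pos_and_le (t : ℕ) : 0 < varStep t ∧ varStep t ≤ 4 := by
  induction t using digit_induction with
  | h0 => rw [varStep_zero]; norm_num
  | he t ih => rw [varStep_two_mul]; constructor <;> linarith [ih.1, ih.2]
  | ho t ih => rw [varStep_two_mul_add_one]; constructor <;> linarith [ih.1, ih.2]

theorem varStep_pos (t : ℕ) : 0 < varStep t := (varStep_pos_and_le t).1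

theorem varStep_le (t : ℕ) : varStep t ≤ 4 := (varStep_pos_and_le t).2

theorem digitVar_two_mul_add_one' (t : ℕ) :
    digitVar (2 * t + 1) = digitVar t + varStep t / 2 := by
  rw [digitVar_two_mul_add_one, varStep]; ring

theorem digitVar_nonneg (t : ℕ) : 0 ≤ digitVar t := by
  induction t using digit_induction with
  | h0 => rw [digitVar_zero]
  | he t ih => rwa [digitVar_two_mul]
  | ho t ih => rw [digitVar_two_mul_add_one']; linarith [varStep_pos t]

/-- Three times the variance minus the third cumulant of `s(n+t) - s(n)`. -/
noncomputable def skewDefect : ℕ → ℝ :=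
  dyadicRec 0 12 (fun t x y => (x + y) / 2 + 3 / 2 * varStep t)

theorem skewDefect_zero : skewDefect 0 = 0 := dyadicRec_zero

theorem skewDefect_one : skewDefect 1 = 12 := dyadicRec_one

theorem skewDefect_two_mul (t : ℕ) : skewDefect (2 * t) = skewDefect t := dyadicRec_two_mul t

theorem skewDefect_two_mul_add_one (t : ℕ) :
    skewDefect (2 * t + 1) = (skewDefect t + skewDefect (t + 1)) / 2 + 3 / 2 * varStep t :=
  dyadicRec_two_mul_add_one (f := fun t x y => (x + y) / 2 + 3 / 2 * varStep t)
    (by rw [varStep_zero]; norm_num) t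

/-- The bound passes through averages, and the added term is a positive multiple of `varStep`. This
strict positivity is the source of the excess over 1/2. -/
theorem skewDefect_ge (t : ℕ) : 1 ≤ t → 12 ≤ skewDefect t := by
  induction t using dyadic_induction with
  | h0 => intro h; omega
  | h1 => intro _; rw [skewDefect_one]
  | he t ih => intro h; rw [skewDefect_two_mul]; exact ih (by omega)
  | ho t ih ih' =>
    intro _
    rcases Nat.eq_zero_or_pos t with rfl | ht
    · rw [mul_zero, zero_add, skewDefect_one]
    · rw [skewDefect_two_mul_add_one]
      linarith [ih ht, ih' (by omega), varStep_pos t]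

theorem skewDefect_le (t : ℕ) : skewDefect t ≤ 6 * digitVar t := by
  induction t using dyadic_induction with
  | h0 => rw [skewDefect_zero, digitVar_zero]; norm_num
  | h1 => rw [skewDefect_one, digitVar_one]; norm_num
  | he t ih => rwa [skewDefect_two_mul, digitVar_two_mul]
  | ho t ih ih' =>
    rw [skewDefect_two_mul_add_one, digitVar_two_mul_add_one]
    linarith [varStep_le t]

/-! ### Blocks of 1s and the variance -/

/-- Blocks are compared by shifting positions; `s` collects the few blocks that a shift destroys. -/
theorem numOneBlocks_le_of_map {t u k : ℕ} (φ : ℕ × ℕ → ℕ × ℕ) (s : Finset (ℕ × ℕ))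
    (hs : s.card ≤ k)
    (hφ : ∀ b, IsMaximalOneBlock t b.1 b.2 → b ∉ s → IsMaximalOneBlock u (φ b).1 (φ b).2)
    (hinj : ∀ b c, IsMaximalOneBlock t b.1 b.2 → IsMaximalOneBlock t c.1 c.2 → b ∉ s → c ∉ s →
      φ b = φ c → b = c) :
    numOneBlocks t ≤ numOneBlocks u + k := by
  classical
  have h1 : {b : ℕ × ℕ | IsMaximalOneBlock t b.1 b.2} ⊆
      ({b : ℕ × ℕ | IsMaximalOneBlock t b.1 b.2} \ s) ∪ s := by
    intro b hb
    by_cases h : b ∈ s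
    · exact Or.inr h
    · exact Or.inl ⟨hb, h⟩
  have hfin := finite_maximalOneBlocks t
  have h2 : ({b : ℕ × ℕ | IsMaximalOneBlock t b.1 b.2} \ (s : Set (ℕ × ℕ))).ncard ≤
      numOneBlocks u := by
    refine Set.ncard_le_ncard_of_injOn φ (fun b hb => hφ b hb.1 hb.2) ?_
      (finite_maximalOneBlocks u)
    intro b hb c hc h
    exact hinj b c hb.1 hc.1 hb.2 hc.2 h
  calc numOneBlocks t ≤ _ := Set.ncard_le_ncard h1 ((hfin.sdiff).union s.finite_toSet)
    _ ≤ _ := Set.ncard_union_le _ _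
    _ ≤ numOneBlocks u + k := by
      rw [Set.ncard_coe_finset]
      omega

theorem numOneBlocks_two_mul_le (t : ℕ) : numOneBlocks (2 * t) ≤ numOneBlocks t := by
  have hb (i : ℕ) : (2 * t).testBit (i + 1) = t.testBit i := by
    rw [Nat.testBit_succ]; congr 1; omega
  have hμ : ∀ b : ℕ × ℕ, IsMaximalOneBlock (2 * t) b.1 b.2 → 1 ≤ b.1 := by
    rintro ⟨μ, ν⟩ ⟨h1, h2, -, -⟩
    by_contra h
    have : μ = 0 := by simp at h; omega
    subst this
    have := h2 0 le_rfl (by simp at h1 ⊢; omega)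
    simp at this
  refine numOneBlocks_le_of_map (k := 0) (fun b => (b.1 - 1, b.2)) ∅ (by simp) ?_ ?_
  · rintro ⟨μ, ν⟩ h -
    have h0 := hμ _ h
    obtain ⟨h1, h2, h3, h4⟩ := h
    simp only at *
    obtain ⟨μ, rfl⟩ : ∃ k, μ = k + 1 := ⟨μ - 1, by omega⟩
    refine ⟨h1, fun i hi hi' => ?_, ?_, ?_⟩
    · rw [← hb]; exact h2 _ (by omega) (by omega)
    · rw [← hb, ← h3]; congr 1; omega
    · rcases μ with _ | μ
      · simp
      · right
        rw [← hb]
        simpa using h4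
  · rintro ⟨μ, ν⟩ ⟨μ', ν'⟩ h h' - - he
    have := hμ _ h
    have := hμ _ h'
    simp only [Prod.mk.injEq] at *
    omega

theorem numOneBlocks_four_mul_add_one_le (t : ℕ) :
    numOneBlocks (4 * t + 1) ≤ numOneBlocks t + 1 := by
  have hb (i : ℕ) : (4 * t + 1).testBit (i + 2) = t.testBit i := by
    rw [Nat.testBit_succ, Nat.testBit_succ]; congr 1; omega
  have hb1 : (4 * t + 1).testBit 1 = false := by
    rw [Nat.testBit_succ, Nat.testBit_zero]; simp; omega
  have hμ : ∀ b : ℕ × ℕ, IsMaximalOneBlock (4 * t + 1) b.1 b.2 →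
      b ∉ ({(0, 1)} : Finset (ℕ × ℕ)) → 2 ≤ b.1 := by
    rintro ⟨μ, ν⟩ ⟨h1, h2, h3, -⟩ hn
    by_contra h
    simp only at *
    have h5 : μ = 0 ∨ μ = 1 := by omega
    rcases h5 with rfl | rfl
    · have : ν ≠ 1 := by rintro rfl; simp at hn
      have := h2 1 (by omega) (by omega)
      rw [hb1] at this
      cases this
    · have := h2 1 (by omega) (by omega)
      rw [hb1] at this
      cases this
  refine numOneBlocks_le_of_map (fun b => (b.1 - 2, b.2)) {(0, 1)} (by simp) ?_ ?_
  · rintro ⟨μ, ν⟩ h hn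
    have h0 := hμ _ h hn
    obtain ⟨h1, h2, h3, h4⟩ := h
    simp only at *
    obtain ⟨μ, rfl⟩ : ∃ k, μ = k + 2 := ⟨μ - 2, by omega⟩
    refine ⟨h1, fun i hi hi' => ?_, ?_, ?_⟩
    · rw [← hb]; exact h2 _ (by omega) (by omega)
    · rw [← hb, ← h3]; congr 1; omega
    · rcases μ with _ | μ
      · simp
      · right
        rw [← hb]
        simpa using h4
  · rintro ⟨μ, ν⟩ ⟨μ', ν'⟩ h h' hn hn' he
    have := hμ _ h hn
    have := hμ _ h' hn'
    simp only [Prod.mk.injEq] at *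
    omega

theorem numOneBlocks_four_mul_add_three_le (t : ℕ) :
    numOneBlocks (4 * t + 3) ≤ numOneBlocks (2 * t + 1) := by
  have hb (i : ℕ) : (4 * t + 3).testBit (i + 1) = (2 * t + 1).testBit i := by
    rw [Nat.testBit_succ]; congr 1; omega
  have hb0 : (4 * t + 3).testBit 0 = true := by
    rw [Nat.testBit_zero]; simp; omega
  have hb1 : (4 * t + 3).testBit 1 = true := by
    rw [hb, Nat.testBit_zero]; simp
  have hμ : ∀ b : ℕ × ℕ, IsMaximalOneBlock (4 * t + 3) b.1 b.2 →
      (b.1 = 0 ∧ 2 ≤ b.2) ∨ 2 ≤ b.1 := by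
    rintro ⟨μ, ν⟩ ⟨h1, h2, h3, h4⟩
    simp only at *
    rcases Nat.lt_or_ge μ 2 with h | h
    · interval_cases μ
      · left
        refine ⟨rfl, ?_⟩
        by_contra h
        have : ν = 1 := by omega
        subst this
        rw [zero_add, hb1] at h3
        cases h3
      · rcases h4 with h4 | h4
        · cases h4
        · rw [Nat.sub_self, hb0] at h4
          cases h4
    · exact Or.inr h
  refine numOneBlocks_le_of_map (k := 0)
    (fun b => if b.1 = 0 then (0, b.2 - 1) else (b.1 - 1, b.2)) ∅ (by simp) ?_ ?_
  · rintro ⟨μ, ν⟩ h -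
    have h0 := hμ _ h
    obtain ⟨h1, h2, h3, h4⟩ := h
    simp only at *
    rcases h0 with ⟨rfl, h0⟩ | h0
    · rw [if_pos rfl]
      refine ⟨by simp only; omega, fun i _ hi' => ?_, ?_, Or.inl rfl⟩
      · simp only at hi'
        rw [← hb]; exact h2 _ (by omega) (by omega)
      · rw [← hb, ← h3]; congr 1; simp only; omega
    · rw [if_neg (by omega)]
      obtain ⟨μ, rfl⟩ : ∃ k, μ = k + 2 := ⟨μ - 2, by omega⟩
      refine ⟨h1, fun i hi hi' => ?_, ?_, ?_⟩
      · simp only at hi hi'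
        rw [← hb]; exact h2 _ (by omega) (by omega)
      · rw [← hb, ← h3]; congr 1; simp only; omega
      · right
        rw [← hb]
        simpa using h4
  · rintro ⟨μ, ν⟩ ⟨μ', ν'⟩ h h' - - he
    have h5 := hμ _ h
    have h6 := hμ _ h'
    simp only at he h5 h6
    split_ifs at he <;> simp only [Prod.mk.injEq] at * <;> omega

theorem numOneBlocks_zero : numOneBlocks 0 = 0 := by
  rw [numOneBlocks, Set.ncard_eq_zero (finite_maximalOneBlocks 0), Set.eq_empty_iff_forall_notMem]
  rintro ⟨μ, ν⟩ ⟨h1, h2, -, -⟩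
  have := h2 μ le_rfl (by simp at h1; omega)
  simp at this

/-- Appending 01 can create one block and raises the variance by 1 + e/4, with e = `varStep u` > 0.
Appending 0, or lengthening a final run of 1s, creates no block and never lowers the variance. -/
theorem numOneBlocks_le_digitVar (t : ℕ) : (numOneBlocks t : ℝ) ≤ digitVar t := by
  induction t using Nat.strong_induction_on with
  | _ t ih =>
    rcases Nat.eq_zero_or_pos t with rfl | h
    · simp [numOneBlocks_zero, digitVar_zero]
    · rcases Nat.even_or_odd' t with ⟨s, rfl | rfl⟩
      · rw [digitVar_two_mul]
        refine le_trans ?_ (ih s (by omega))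
        exact_mod_cast numOneBlocks_two_mul_le s
      · rcases Nat.even_or_odd' s with ⟨u, rfl | rfl⟩
        · have h1 := ih u (by omega)
          have h2 := numOneBlocks_four_mul_add_one_le u
          rw [show 4 * u + 1 = 2 * (2 * u) + 1 by ring] at h2
          have h3 : (numOneBlocks (2 * (2 * u) + 1) : ℝ) ≤ numOneBlocks u + 1 := by
            exact_mod_cast h2
          rw [digitVar_two_mul_add_one', digitVar_two_mul, varStep_two_mul]
          linarith [varStep_pos u]
        · have h1 := ih (2 * u + 1) (by omega)
          have h2 := numOneBlocks_four_mul_add_three_le u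
          rw [show 4 * u + 3 = 2 * (2 * u + 1) + 1 by ring] at h2
          have h3 : (numOneBlocks (2 * (2 * u + 1) + 1) : ℝ) ≤ numOneBlocks (2 * u + 1) := by
            exact_mod_cast h2
          rw [digitVar_two_mul_add_one']
          linarith [varStep_pos (2 * u + 1)]

/-! ### Characteristic functions -/

open Complex in
/-- The characteristic function of `G - 1`, where `G` is geometrically distributed with
parameter `1/2` on the nonnegative integers. -/
noncomputable def geomChar (θ : ℝ) : ℂ := exp (-(θ * I)) / (2 - exp (θ * I))

open Complex in
/-- The characteristic function of the limit distribution of `s(n+t) - s(n)`. -/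
noncomputable def charFn (t : ℕ) (θ : ℝ) : ℂ :=
  dyadicRec 1 (geomChar (-θ)) (fun _ x y => (exp (θ * I) * x + exp (-(θ * I)) * y) / 2) t

section charFn

open Complex

theorem two_sub_exp_ne_zero (θ : ℝ) : (2 : ℂ) - exp (θ * I) ≠ 0 := by
  intro h
  have h1 : ‖exp (θ * I)‖ = 2 := by
    rw [← sub_eq_zero.1 h]; simp
  rw [norm_exp_ofReal_mul_I] at h1
  norm_num at h1

theorem norm_exp_neg_ofReal_mul_I (θ : ℝ) : ‖exp (-(θ * I))‖ = 1 := by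
  rw [← neg_mul, ← ofReal_neg, norm_exp_ofReal_mul_I]

theorem exp_mul_exp_neg (z : ℂ) : exp z * exp (-z) = 1 := by
  rw [← exp_add, add_neg_cancel, exp_zero]

theorem charFn_zero (θ : ℝ) : charFn 0 θ = 1 := dyadicRec_zero

theorem charFn_one (θ : ℝ) : charFn 1 θ = geomChar (-θ) := dyadicRec_one

theorem charFn_two_mul (t : ℕ) (θ : ℝ) : charFn (2 * t) θ = charFn t θ := dyadicRec_two_mul t

theorem charFn_two_mul_add_one (t : ℕ) (θ : ℝ) :
    charFn (2 * t + 1) θ =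
      (exp (θ * I) * charFn t θ + exp (-(θ * I)) * charFn (t + 1) θ) / 2 := by
  refine dyadicRec_two_mul_add_one
    (f := fun _ x y => (exp (θ * I) * x + exp (-(θ * I)) * y) / 2) ?_ t
  have h := two_sub_exp_ne_zero (-θ)
  simp only [geomChar, ofReal_neg, neg_mul, neg_neg] at h ⊢
  field_simp
  ring

theorem continuous_geomChar : Continuous geomChar := by
  unfold geomChar
  exact Continuous.div (by fun_prop) (by fun_prop) two_sub_exp_ne_zero

theorem continuous_charFn (t : ℕ) : Continuous (charFn t) := by
  induction t using dyadic_induction with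
  | h0 => rw [show charFn 0 = fun _ => 1 from funext charFn_zero]; fun_prop
  | h1 =>
    rw [show charFn 1 = fun θ => geomChar (-θ) from funext charFn_one]
    exact continuous_geomChar.comp continuous_neg
  | he t ih => rwa [show charFn (2 * t) = charFn t from funext (charFn_two_mul t)]
  | ho t ih ih' =>
    rw [show charFn (2 * t + 1) = _ from funext (charFn_two_mul_add_one t)]
    fun_prop

theorem norm_half_combination_le {a b x y : ℂ} {B : ℝ} (ha : ‖a‖ = 1) (hb : ‖b‖ = 1)
    (hx : ‖x‖ ≤ B) (hy : ‖y‖ ≤ B) : ‖(a * x + b * y) / 2‖ ≤ B := by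
  rw [norm_div, norm_ofNat]
  have := norm_add_le (a * x) (b * y)
  rw [norm_mul, norm_mul, ha, hb] at this
  linarith

theorem norm_exp_sub_one_le (θ : ℝ) : ‖exp (θ * I) - 1‖ ≤ |θ| := by
  have := Real.norm_exp_I_mul_ofReal_sub_one_le (x := θ)
  rwa [mul_comm I, Real.norm_eq_abs] at this

theorem norm_geomChar_sub_one_le (θ : ℝ) : ‖geomChar θ - 1‖ ≤ 3 * |θ| := by
  have h0 := two_sub_exp_ne_zero θ
  have h1 : geomChar θ - 1 = ((exp (-(θ * I)) - 1) + (exp (θ * I) - 1)) / (2 - exp (θ * I)) := by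
    rw [geomChar, div_sub_one h0]; ring
  have h2 : 1 ≤ ‖2 - exp (θ * I)‖ := by
    have := norm_sub_norm_le 2 (exp (θ * I))
    rw [norm_exp_ofReal_mul_I, norm_ofNat] at this
    linarith
  have h3 := norm_exp_sub_one_le θ
  have h4 := norm_exp_sub_one_le (-θ)
  rw [ofReal_neg, neg_mul, abs_neg] at h4
  rw [h1, norm_div]
  refine (div_le_self (norm_nonneg _) h2).trans ?_
  refine (norm_add_le _ _).trans ?_
  linarith [abs_nonneg θ]

/-- This first order bound at 0 makes the quotients by sin(θ/2) integrable. -/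
theorem exists_norm_charFn_sub_one_le (t : ℕ) : ∃ C, ∀ θ, ‖charFn t θ - 1‖ ≤ C * |θ| := by
  induction t using dyadic_induction with
  | h0 => exact ⟨0, fun θ => by simp [charFn_zero]⟩
  | h1 =>
    refine ⟨3, fun θ => ?_⟩
    rw [charFn_one]
    simpa using norm_geomChar_sub_one_le (-θ)
  | he t ih => simpa only [charFn_two_mul] using ih
  | ho t ih ih' =>
    obtain ⟨C, hC⟩ := ih
    obtain ⟨C', hC'⟩ := ih'
    refine ⟨(C + C' + 2) / 2, fun θ => ?_⟩
    rw [charFn_two_mul_add_one]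
    have h1 := norm_exp_sub_one_le θ
    have h2 := norm_exp_sub_one_le (-θ)
    rw [ofReal_neg, neg_mul, abs_neg] at h2
    have h3 : (exp (θ * I) * charFn t θ + exp (-(θ * I)) * charFn (t + 1) θ) / 2 - 1 =
        (exp (θ * I) * (charFn t θ - 1) + exp (-(θ * I)) * (charFn (t + 1) θ - 1)
          + (exp (θ * I) - 1) + (exp (-(θ * I)) - 1)) / 2 := by ring
    rw [h3, norm_div, norm_ofNat]
    have h4 := norm_add_le (exp (θ * I) * (charFn t θ - 1) +
      exp (-(θ * I)) * (charFn (t + 1) θ - 1) + (exp (θ * I) - 1)) (exp (-(θ * I)) - 1)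
    have h5 := norm_add_le (exp (θ * I) * (charFn t θ - 1) +
      exp (-(θ * I)) * (charFn (t + 1) θ - 1)) (exp (θ * I) - 1)
    have h6 := norm_add_le (exp (θ * I) * (charFn t θ - 1))
      (exp (-(θ * I)) * (charFn (t + 1) θ - 1))
    rw [norm_mul, norm_mul, norm_exp_ofReal_mul_I, norm_exp_neg_ofReal_mul_I] at h6
    linarith [hC θ, hC' θ]

/-! ### Gaussian decay of the characteristic functions -/

/-- The squared modulus is 5/16 + cos(θ)/4 ≤ 9/16 - θ^2/20, and 9/16 - θ^2/20 is (3/4 - θ^2/30)^2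
without its θ^4 term. -/
theorem norm_quarter_add_half_exp_le {θ : ℝ} (hθ : |θ| ≤ Real.pi) :
    ‖(1 / 4 : ℂ) + exp (θ * I) / 2‖ ≤ 3 / 4 - θ ^ 2 / 30 := by
  have hpi : Real.pi ^ 2 ≤ 9.9 := by
    have h1 := Real.pi_pos
    have h2 := Real.pi_lt_d4
    nlinarith
  have hpi' : 0 < Real.pi ^ 2 := by positivity
  have hsq : θ ^ 2 ≤ Real.pi ^ 2 := by
    rw [← sq_abs]; gcongr
  have hcos := Real.cos_le_one_sub_mul_cos_sq hθ
  have hc2 : Real.cos θ ≤ 1 - θ ^ 2 / 5 := by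
    have : 1 / 5 ≤ 2 / Real.pi ^ 2 := by
      rw [div_le_div_iff₀ (by norm_num) hpi']; linarith
    nlinarith [sq_nonneg θ]
  have hn : ‖(1 / 4 : ℂ) + exp (θ * I) / 2‖ ^ 2 = 5 / 16 + Real.cos θ / 4 := by
    have h1 : (1 / 4 : ℂ) + exp (θ * I) / 2 =
        ((1 / 4 + Real.cos θ / 2 : ℝ) : ℂ) + ((Real.sin θ / 2 : ℝ) : ℂ) * I := by
      rw [exp_mul_I]; push_cast; ring
    rw [h1, ← normSq_eq_norm_sq, normSq_add_mul_I]
    nlinarith [Real.sin_sq_add_cos_sq θ]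
  refine le_of_sq_le_sq (by rw [hn]; nlinarith [sq_nonneg (θ ^ 2)]) (by linarith)

theorem quarter_contraction {c v x y : ℂ} {B δ : ℝ} (hc : ‖c‖ = 1)
    (hv : ‖(1 / 4 : ℂ) + v / 2‖ ≤ 3 / 4 - δ) (hx : ‖x‖ ≤ B) (hy : ‖y‖ ≤ B) :
    ‖c / 4 * x + (1 / 4 + v / 2) * y‖ ≤ Real.exp (-δ) * B := by
  have hB : 0 ≤ B := (norm_nonneg _).trans hx
  have h1 : 1 - δ ≤ Real.exp (-δ) := by linarith [Real.add_one_le_exp (-δ)]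
  have h2 := norm_add_le (c / 4 * x) ((1 / 4 + v / 2) * y)
  rw [norm_mul, norm_mul, norm_div, hc, norm_ofNat] at h2
  have h3 : ‖(1 / 4 : ℂ) + v / 2‖ * ‖y‖ ≤ (3 / 4 - δ) * B :=
    mul_le_mul hv hy (norm_nonneg _) ((norm_nonneg _).trans hv)
  nlinarith

/-- Consecutive values of the characteristic function are bounded by `B`. -/
def PairBound (t : ℕ) (θ B : ℝ) : Prop := ‖charFn t θ‖ ≤ B ∧ ‖charFn (t + 1) θ‖ ≤ B

theorem PairBound.two_mul {t : ℕ} {θ B : ℝ} (h : PairBound t θ B) : PairBound (2 * t) θ B := by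
  refine ⟨by rw [charFn_two_mul]; exact h.1, ?_⟩
  rw [charFn_two_mul_add_one]
  exact norm_half_combination_le (norm_exp_ofReal_mul_I θ) (norm_exp_neg_ofReal_mul_I θ) h.1 h.2

theorem PairBound.two_mul_add_one {t : ℕ} {θ B : ℝ} (h : PairBound t θ B) :
    PairBound (2 * t + 1) θ B := by
  refine ⟨h.two_mul.2, ?_⟩
  rw [show 2 * t + 1 + 1 = 2 * (t + 1) by ring, charFn_two_mul]
  exact h.2

theorem PairBound.mono {t : ℕ} {θ B B' : ℝ} (h : PairBound t θ B) (hB : B ≤ B') :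
    PairBound t θ B' := ⟨h.1.trans hB, h.2.trans hB⟩

/-- Unfolding the recursion reaches one of the two earlier values along two paths whose phases
differ, with weights 1/4 and 1/2. These paths interfere, which saves the factor exp(-θ^2/30). -/
theorem PairBound.of_two_mod_four {u : ℕ} {θ B : ℝ} (hθ : |θ| ≤ Real.pi) (h : PairBound u θ B) :
    PairBound (2 * (2 * (2 * u) + 1)) θ (Real.exp (-(θ ^ 2 / 30)) * B) ∧
      PairBound (2 * (2 * (2 * u + 1) + 1)) θ (Real.exp (-(θ ^ 2 / 30)) * B) := by
  have hee := exp_mul_exp_neg (θ * I)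
  have hv := norm_quarter_add_half_exp_le hθ
  have hv' := norm_quarter_add_half_exp_le (θ := -θ) (by rwa [abs_neg])
  rw [ofReal_neg, neg_mul, neg_sq] at hv'
  have hn := norm_exp_ofReal_mul_I θ
  have hn' := norm_exp_neg_ofReal_mul_I θ
  have hc1 : ‖exp (-(θ * I)) ^ 2‖ = 1 := by rw [norm_pow, hn', one_pow]
  have hc2 : ‖exp (θ * I) ^ 2‖ = 1 := by rw [norm_pow, hn, one_pow]
  -- Here x collects the coefficient 1/4 + exp(iθ)/2; in `key2` the coefficient of y is its
  -- conjugate.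
  have key1 : ∀ x y : ℂ, ‖x‖ ≤ B → ‖y‖ ≤ B →
      ‖(exp (θ * I) * x + exp (-(θ * I)) * ((exp (θ * I) * x + exp (-(θ * I)) * y) / 2)) / 2‖
        ≤ Real.exp (-(θ ^ 2 / 30)) * B := by
    intro x y hx hy
    refine le_of_eq_of_le (congrArg norm ?_) (quarter_contraction hc1 hv hy hx)
    linear_combination (x / 4) * hee
  have key2 : ∀ x y : ℂ, ‖x‖ ≤ B → ‖y‖ ≤ B →
      ‖(exp (θ * I) * ((exp (θ * I) * x + exp (-(θ * I)) * y) / 2) + exp (-(θ * I)) * y) / 2‖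
        ≤ Real.exp (-(θ ^ 2 / 30)) * B := by
    intro x y hx hy
    refine le_of_eq_of_le (congrArg norm ?_) (quarter_contraction hc2 hv' hx hy)
    linear_combination (y / 4) * hee
  have h0 := h.two_mul
  have h1 := h.two_mul_add_one
  refine ⟨⟨?_, ?_⟩, ⟨?_, ?_⟩⟩
  · rw [charFn_two_mul, charFn_two_mul_add_one, charFn_two_mul, charFn_two_mul_add_one]
    exact key1 _ _ h.1 h.2
  · rw [charFn_two_mul_add_one, charFn_two_mul_add_one,
      show 2 * (2 * u) + 1 + 1 = 2 * (2 * u + 1) by ring, charFn_two_mul (2 * u + 1)]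
    exact key2 _ _ h0.1 h0.2
  · rw [charFn_two_mul, charFn_two_mul_add_one, charFn_two_mul_add_one,
      show 2 * u + 1 + 1 = 2 * (u + 1) by ring, charFn_two_mul (u + 1)]
    exact key2 _ _ h.1 h.2
  · rw [charFn_two_mul_add_one, charFn_two_mul_add_one,
      show 2 * (2 * u + 1) + 1 + 1 = 2 * (2 * u + 1 + 1) by ring, charFn_two_mul (2 * u + 1 + 1)]
    exact key2 _ _ h1.1 h1.2

theorem digitVar_succ (t : ℕ) : digitVar (t + 1) = digitVar t + varStep t - 2 := by
  rw [varStep]; ring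

/-- The exponent for odd t is chosen to be unaffected by further trailing 1s, since 2s+2 and s+1
have equal variance. Passing from even s to 2s+1 does not increase it because `varStep` is at most
4. Hence a real gain is needed only for t ≡ 2 mod 4. -/
theorem pairBound_charFn {θ : ℝ} (hθ : |θ| ≤ Real.pi) (t : ℕ) :
    PairBound t θ (Real.exp (-(θ ^ 2 / 240) * if Even t then digitVar t else
      digitVar (t + 1) - 2)) := by
  induction t using Nat.strong_induction_on with
  | _ t ih =>
    rcases Nat.eq_zero_or_pos t with rfl | ht
    · have h0 : PairBound 0 θ 1 := by
        refine ⟨by rw [charFn_zero, norm_one], ?_⟩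
        rw [charFn_one, geomChar, norm_div, ofReal_neg, neg_mul, neg_neg, norm_exp_ofReal_mul_I]
        refine div_le_one_of_le₀ ?_ (norm_nonneg _)
        have := norm_sub_norm_le 2 (exp (-(θ * I)))
        rw [norm_exp_neg_ofReal_mul_I, norm_ofNat] at this
        linarith
      simpa [digitVar_zero] using h0
    · rcases Nat.even_or_odd' t with ⟨s, rfl | rfl⟩
      · rcases Nat.even_or_odd' s with ⟨r, rfl | rfl⟩
        · refine (ih (2 * r) (by omega)).two_mul.mono (le_of_eq ?_)
          simp [digitVar_two_mul]
        · obtain ⟨u, hu⟩ := Nat.even_or_odd' r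
          -- For either parity of u the known exponent is at least `digitVar u - 4`. The factor
          -- exp(-θ^2/30) = exp(-8·θ^2/240) gives back 8, while the three new digits raise the
          -- variance by at most 3.
          have h1 : PairBound u θ (Real.exp (-(θ ^ 2 / 240) * (digitVar u - 4))) := by
            refine (ih u (by omega)).mono (Real.exp_le_exp.2 ?_)
            have h2 := digitVar_succ u
            have h3 := varStep_pos u
            split_ifs
            · nlinarith [sq_nonneg θ]
            · nlinarith [sq_nonneg θ]
          obtain ⟨h2, h3⟩ := h1.of_two_mod_four hθ
          rw [← Real.exp_add] at h2 h3
          have h4 := varStep_le u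
          rcases hu with rfl | rfl
          · refine h2.mono (Real.exp_le_exp.2 ?_)
            rw [if_pos (by simp), digitVar_two_mul, digitVar_two_mul_add_one', digitVar_two_mul,
              varStep_two_mul]
            nlinarith [sq_nonneg θ]
          · refine h3.mono (Real.exp_le_exp.2 ?_)
            rw [if_pos (by simp), digitVar_two_mul, digitVar_two_mul_add_one',
              digitVar_two_mul_add_one', varStep_two_mul_add_one]
            nlinarith [sq_nonneg θ]
      · rw [if_neg (by simp), show 2 * s + 1 + 1 = 2 * (s + 1) by ring, digitVar_two_mul]
        refine (ih s (by omega)).two_mul_add_one.mono (Real.exp_le_exp.2 ?_)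
        split_ifs with hs
        · have h2 := digitVar_succ s
          have h3 := varStep_le s
          nlinarith [sq_nonneg θ]
        · exact le_rfl

theorem norm_charFn_le {θ : ℝ} (hθ : |θ| ≤ Real.pi) (t : ℕ) :
    ‖charFn t θ‖ ≤ Real.exp (-(θ ^ 2 / 240) * (digitVar t - 4)) := by
  refine (pairBound_charFn hθ t).1.trans (Real.exp_le_exp.2 ?_)
  have h2 := digitVar_succ t
  have h3 := varStep_pos t
  split_ifs
  · nlinarith [sq_nonneg θ]
  · nlinarith [sq_nonneg θ]

end charFn

/-! ### Fourier representation of tails -/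

open Complex in
/-- If `f` is the characteristic function of an integer random variable `X`, the integrand
of the Fourier representation of `P(X ≥ j) - P(X < j)`. -/
noncomputable def tailIntegrand (f : ℝ → ℂ) (j : ℤ) (θ : ℝ) : ℝ :=
  (exp ((((1 / 2 - j) * θ : ℝ) : ℂ) * I) * f θ).im / Real.sin (θ / 2)

/-- If `f` is the characteristic function of an integer random variable `X`, this is
`P(X ≥ j) - P(X < j)`. -/
noncomputable def signedTail (f : ℝ → ℂ) (j : ℤ) : ℝ :=
  Real.pi⁻¹ * ∫ θ in 0..Real.pi, tailIntegrand f j θ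

section signedTail

open Complex

theorem div_pi_le_sin_half {θ : ℝ} (h0 : 0 ≤ θ) (h1 : θ ≤ Real.pi) :
    θ / Real.pi ≤ Real.sin (θ / 2) := by
  have h := Real.mul_le_sin (x := θ / 2) (by linarith) (by linarith)
  refine le_of_eq_of_le ?_ h
  field_simp

theorem abs_im_div_sin_half_le {z : ℂ} {θ B : ℝ} (h0 : 0 < θ) (h1 : θ ≤ Real.pi)
    (h : ‖z‖ ≤ B * θ) : |z.im / Real.sin (θ / 2)| ≤ Real.pi * B := by
  have h3 := div_pi_le_sin_half h0.le h1
  have hpi := Real.pi_pos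
  have h4 : 0 < θ / Real.pi := by positivity
  have hB : 0 ≤ B := by
    have := (norm_nonneg _).trans h
    exact nonneg_of_mul_nonneg_left this h0
  rw [abs_div, abs_of_pos (h4.trans_le h3), div_le_iff₀ (h4.trans_le h3)]
  calc |z.im| ≤ B * θ := (abs_im_le_norm z).trans h
    _ = Real.pi * B * (θ / Real.pi) := by field_simp
    _ ≤ _ := by gcongr

theorem measurable_im_div_sin_half {f : ℝ → ℂ} (hf : Continuous f) :
    Measurable fun θ : ℝ => (f θ).im / Real.sin (θ / 2) :=
  (continuous_im.comp hf).measurable.div (by fun_prop)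

/-- The quotient of a continuous function by `sin (θ/2)` is integrable if the imaginary part of
the function vanishes to first order at `0`. -/
theorem intervalIntegrable_im_div_sin_half {f : ℝ → ℂ} (hf : Continuous f) {B : ℝ} {r : ℝ}
    (h : ∀ θ, 0 < θ → θ ≤ Real.pi → ‖f θ - r‖ ≤ B * θ) :
    IntervalIntegrable (fun θ : ℝ => (f θ).im / Real.sin (θ / 2)) MeasureTheory.volume
      0 Real.pi := by
  rw [intervalIntegrable_iff, Set.uIoc_of_le Real.pi_pos.le]
  refine MeasureTheory.Measure.integrableOn_of_bounded (M := Real.pi * B) (by simp)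
    (measurable_im_div_sin_half hf).aestronglyMeasurable ?_
  rw [MeasureTheory.ae_restrict_iff' measurableSet_Ioc]
  refine MeasureTheory.ae_of_all _ fun θ hθ => ?_
  have := abs_im_div_sin_half_le hθ.1 hθ.2 (h θ hθ.1 hθ.2)
  rw [sub_im, ofReal_im, sub_zero] at this
  exact this

theorem norm_exp_mul_sub_one_le {f : ℝ → ℂ} {C : ℝ} (hC : ∀ θ, ‖f θ - 1‖ ≤ C * |θ|)
    (x : ℝ) {θ : ℝ} (h0 : 0 < θ) :
    ‖exp (((x * θ : ℝ) : ℂ) * I) * f θ - (1 : ℝ)‖ ≤ (C + |x|) * θ := by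
  have h1 : exp (((x * θ : ℝ) : ℂ) * I) * f θ - (1 : ℝ) =
      exp (((x * θ : ℝ) : ℂ) * I) * (f θ - 1) + (exp (((x * θ : ℝ) : ℂ) * I) - 1) := by
    push_cast; ring
  rw [h1]
  refine (norm_add_le _ _).trans ?_
  rw [norm_mul, norm_exp_ofReal_mul_I]
  have h2 := norm_exp_sub_one_le (x * θ)
  have h3 := hC θ
  rw [abs_mul, abs_of_pos h0] at h2
  rw [abs_of_pos h0] at h3
  linarith

theorem intervalIntegrable_tailIntegrand {f : ℝ → ℂ} (hf : Continuous f) {C : ℝ}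
    (hC : ∀ θ, ‖f θ - 1‖ ≤ C * |θ|) (j : ℤ) :
    IntervalIntegrable (tailIntegrand f j) MeasureTheory.volume 0 Real.pi :=
  intervalIntegrable_im_div_sin_half (f := fun θ => exp ((((1 / 2 - j) * θ : ℝ) : ℂ) * I) * f θ)
    (by fun_prop) (r := 1) fun _ h0 _ => norm_exp_mul_sub_one_le hC _ h0

/-- Linear growth in j is all that is needed to exclude an exponentially growing solution of the
recursion for t = 1. -/
theorem abs_signedTail_le {f : ℝ → ℂ} {C : ℝ}
    (hC : ∀ θ, ‖f θ - 1‖ ≤ C * |θ|) (j : ℤ) :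
    |signedTail f j| ≤ Real.pi * (C + 1 / 2 + |(j : ℝ)|) := by
  have h1 : ‖∫ θ in 0..Real.pi, tailIntegrand f j θ‖ ≤
      Real.pi * (C + 1 / 2 + |(j : ℝ)|) * |Real.pi - 0| := by
    refine intervalIntegral.norm_integral_le_of_norm_le_const fun θ hθ => ?_
    rw [Set.uIoc_of_le Real.pi_pos.le] at hθ
    have h2 := norm_exp_mul_sub_one_le hC (1 / 2 - j) hθ.1
    have h3 := abs_im_div_sin_half_le hθ.1 hθ.2 h2
    rw [sub_im, ofReal_im, sub_zero] at h3
    refine h3.trans ?_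
    have h4 := abs_sub (1 / 2 : ℝ) j
    rw [abs_of_pos (by norm_num : (0 : ℝ) < 1 / 2)] at h4
    have := Real.pi_pos
    exact mul_le_mul_of_nonneg_left (by linarith) this.le
  rw [signedTail, abs_mul, abs_of_pos (inv_pos.2 Real.pi_pos)]
  rw [sub_zero, abs_of_pos Real.pi_pos, Real.norm_eq_abs] at h1
  rw [inv_mul_le_iff₀ Real.pi_pos]
  linarith

theorem signedTail_charFn_two_mul (t : ℕ) (j : ℤ) :
    signedTail (charFn (2 * t)) j = signedTail (charFn t) j := by
  rw [show charFn (2 * t) = charFn t from funext (charFn_two_mul t)]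

/-- The phases exp(±iθ) in the recursion of `charFn` shift j by ∓1, which is exactly the shift in
the parity recursion for densities. -/
theorem signedTail_charFn_two_mul_add_one (t : ℕ) (j : ℤ) :
    signedTail (charFn (2 * t + 1)) j =
      (signedTail (charFn t) (j - 1) + signedTail (charFn (t + 1)) (j + 1)) / 2 := by
  obtain ⟨C, hC⟩ := exists_norm_charFn_sub_one_le t
  obtain ⟨C', hC'⟩ := exists_norm_charFn_sub_one_le (t + 1)
  have h1 := intervalIntegrable_tailIntegrand (continuous_charFn t) hC (j - 1)
  have h2 := intervalIntegrable_tailIntegrand (continuous_charFn (t + 1)) hC' (j + 1)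
  have h3 : ∀ θ, tailIntegrand (charFn (2 * t + 1)) j θ =
      (tailIntegrand (charFn t) (j - 1) θ + tailIntegrand (charFn (t + 1)) (j + 1) θ) / 2 := by
    intro θ
    have h4 : exp ((((1 / 2 - j) * θ : ℝ) : ℂ) * I) * charFn (2 * t + 1) θ =
        (exp ((((1 / 2 - ((j - 1 : ℤ) : ℝ)) * θ : ℝ) : ℂ) * I) * charFn t θ +
          exp ((((1 / 2 - ((j + 1 : ℤ) : ℝ)) * θ : ℝ) : ℂ) * I) * charFn (t + 1) θ) / 2 := by
      rw [charFn_two_mul_add_one, mul_div_assoc', mul_add, ← mul_assoc, ← mul_assoc, ← exp_add,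
        ← exp_add]
      congr 5 <;> · push_cast; ring
    rw [tailIntegrand, tailIntegrand, tailIntegrand, h4, div_ofNat_im, add_im]
    ring
  rw [signedTail, signedTail, signedTail, ← mul_add, ← intervalIntegral.integral_add h1 h2,
    mul_div_assoc, ← intervalIntegral.integral_div]
  simp only [h3]

/-- The sine difference formula cancels sin(θ/2) and leaves 2cos(jθ), whose integral over [0, π]
vanishes for j ≠ 0. -/
theorem signedTail_one_sub_succ (j : ℤ) :
    signedTail (fun _ => 1) j - signedTail (fun _ => 1) (j + 1) = if j = 0 then 2 else 0 := by
  have hC : ∀ θ : ℝ, ‖(1 : ℂ) - 1‖ ≤ 0 * |θ| := fun θ => by simp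
  have h1 := intervalIntegrable_tailIntegrand (f := fun _ => 1) continuous_const hC j
  have h2 := intervalIntegrable_tailIntegrand (f := fun _ => 1) continuous_const hC (j + 1)
  have hpi := Real.pi_pos
  have h3 : ∫ θ in 0..Real.pi,
      (tailIntegrand (fun _ => 1) j θ - tailIntegrand (fun _ => 1) (j + 1) θ) =
      ∫ θ in 0..Real.pi, 2 * Real.cos (j * θ) := by
    refine intervalIntegral.integral_congr_ae (MeasureTheory.ae_of_all _ fun θ hθ => ?_)
    rw [Set.uIoc_of_le hpi.le] at hθ
    have hs : 0 < Real.sin (θ / 2) :=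
      Real.sin_pos_of_pos_of_lt_pi (by linarith [hθ.1]) (by linarith [hθ.2])
    rw [tailIntegrand, tailIntegrand, mul_one, mul_one, exp_ofReal_mul_I_im, exp_ofReal_mul_I_im,
      ← sub_div, div_eq_iff hs.ne', Real.sin_sub_sin]
    push_cast
    rw [show ((1 / 2 - (j : ℝ)) * θ - (1 / 2 - (j + 1)) * θ) / 2 = θ / 2 by ring,
      show ((1 / 2 - (j : ℝ)) * θ + (1 / 2 - (j + 1)) * θ) / 2 = -(j * θ) by ring, Real.cos_neg]
    ring
  rw [signedTail, signedTail, ← mul_sub, ← intervalIntegral.integral_sub h1 h2, h3]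
  split_ifs with hj
  · subst hj
    simp
  · have hj' : (j : ℝ) ≠ 0 := by exact_mod_cast hj
    rw [intervalIntegral.integral_const_mul, intervalIntegral.integral_comp_mul_left _ hj']
    simp [Real.sin_int_mul_pi]

theorem signedTail_one_zero : signedTail (fun _ => 1) 0 = 1 := by
  have hpi := Real.pi_pos
  have h3 : ∫ θ in 0..Real.pi, tailIntegrand (fun _ => 1) 0 θ = ∫ θ in 0..Real.pi, (1 : ℝ) := by
    refine intervalIntegral.integral_congr_ae (MeasureTheory.ae_of_all _ fun θ hθ => ?_)
    rw [Set.uIoc_of_le hpi.le] at hθ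
    have hs : 0 < Real.sin (θ / 2) :=
      Real.sin_pos_of_pos_of_lt_pi (by linarith [hθ.1]) (by linarith [hθ.2])
    rw [tailIntegrand, mul_one, exp_ofReal_mul_I_im, Int.cast_zero,
      show (1 / 2 - 0) * θ = θ / 2 by ring, div_self hs.ne']
  rw [signedTail, h3, intervalIntegral.integral_const, sub_zero, smul_eq_mul, mul_one,
    inv_mul_cancel₀ hpi.ne']

theorem signedTail_one_of_nonpos {j : ℤ} (hj : j ≤ 0) : signedTail (fun _ => 1) j = 1 := by
  induction j, hj using Int.leInductionDown with
  | base => exact signedTail_one_zero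
  | pred j hj ih =>
    have h := signedTail_one_sub_succ (j - 1)
    rw [sub_add_cancel, ih, if_neg (by omega)] at h
    linarith

theorem signedTail_one_of_pos {j : ℤ} (hj : 1 ≤ j) : signedTail (fun _ => 1) j = -1 := by
  induction j, hj using Int.leInduction with
  | base =>
    have h := signedTail_one_sub_succ 0
    rw [signedTail_one_zero, if_pos rfl, zero_add] at h
    linarith
  | succ j hj ih =>
    have h := signedTail_one_sub_succ j
    rw [ih, if_neg (by omega)] at h
    linarith

theorem signedTail_charFn_zero (j : ℤ) :
    signedTail (charFn 0) j = if j ≤ 0 then 1 else -1 := by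
  rw [show charFn 0 = fun _ => 1 from funext charFn_zero]
  split_ifs with h
  · exact signedTail_one_of_nonpos h
  · exact signedTail_one_of_pos (by omega)

/-- For t = 1 the recursion refers to itself: the excess over -1 doubles whenever j grows by 1.
Linear growth then forces the excess to be 0. -/
theorem signedTail_charFn_one_of_two_le {j : ℤ} (hj : 2 ≤ j) :
    signedTail (charFn 1) j = -1 := by
  obtain ⟨C, hC⟩ := exists_norm_charFn_sub_one_le 1
  have hstep : ∀ i : ℤ, 2 ≤ i →
      signedTail (charFn 1) i + 1 = (signedTail (charFn 1) (i + 1) + 1) / 2 := by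
    intro i hi
    have h := signedTail_charFn_two_mul_add_one 0 i
    rw [mul_zero, zero_add, signedTail_charFn_zero, if_neg (by omega)] at h
    linarith
  have hiter : ∀ k : ℕ, signedTail (charFn 1) j + 1 =
      (signedTail (charFn 1) (j + k) + 1) / 2 ^ k := by
    intro k
    induction k with
    | zero => simp
    | succ k ih =>
      rw [ih, hstep (j + k) (by omega), pow_succ, div_div, mul_comm (2 : ℝ)]
      push_cast
      rw [add_assoc]
  have hlim : Filter.Tendsto
      (fun k : ℕ => (Real.pi * (C + 1 / 2 + |(j : ℝ)|) + 1) * ((k : ℝ) ^ 0 / 2 ^ k) +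
        Real.pi * ((k : ℝ) ^ 1 / 2 ^ k)) Filter.atTop (nhds 0) := by
    have h0 := tendsto_pow_const_div_const_pow_of_one_lt 0 (r := (2 : ℝ)) (by norm_num)
    have h1 := tendsto_pow_const_div_const_pow_of_one_lt 1 (r := (2 : ℝ)) (by norm_num)
    simpa using (h0.const_mul (Real.pi * (C + 1 / 2 + |(j : ℝ)|) + 1)).add (h1.const_mul Real.pi)
  have habs : |signedTail (charFn 1) j + 1| ≤ 0 := by
    refine ge_of_tendsto' hlim fun k => ?_
    rw [hiter k, abs_div, abs_of_pos (by positivity : (0 : ℝ) < 2 ^ k), pow_zero, pow_one,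
      mul_div_assoc', mul_div_assoc', ← add_div]
    gcongr
    have h1 := abs_signedTail_le hC (j + k)
    have h2 : |((j + k : ℤ) : ℝ)| ≤ |(j : ℝ)| + k := by
      push_cast
      exact (abs_add_le _ _).trans (by simp)
    have h3 := abs_add_le (signedTail (charFn 1) (j + k)) 1
    rw [abs_one] at h3
    nlinarith [Real.pi_pos]
  have := abs_nonpos_iff.1 habs
  linarith

end signedTail

/-! ### Existence of the densities -/

theorem binaryDigitSum_two_mul (n : ℕ) : binaryDigitSum (2 * n) = binaryDigitSum n := by
  rcases Nat.eq_zero_or_pos n with rfl | h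
  · rfl
  · rw [binaryDigitSum, binaryDigitSum, Nat.digits_def' (by norm_num) (by omega)]
    simp

theorem binaryDigitSum_two_mul_add_one (n : ℕ) :
    binaryDigitSum (2 * n + 1) = binaryDigitSum n + 1 := by
  rw [binaryDigitSum, binaryDigitSum, Nat.digits_def' (by norm_num) (by omega),
    show (2 * n + 1) % 2 = 1 by omega, show (2 * n + 1) / 2 = n by omega, List.sum_cons, add_comm]

theorem binaryDigitSum_succ_le (n : ℕ) : binaryDigitSum (n + 1) ≤ binaryDigitSum n + 1 := by
  induction n using digit_induction with
  | h0 => simp [binaryDigitSum]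
  | he n ih => rw [binaryDigitSum_two_mul_add_one, binaryDigitSum_two_mul]
  | ho n ih =>
    rw [show 2 * n + 1 + 1 = 2 * (n + 1) by ring, binaryDigitSum_two_mul,
      binaryDigitSum_two_mul_add_one]
    omega

/-- The set of `n` with `s(n+t) - s(n) ≥ j`. -/
def digitGainSet (t : ℕ) (j : ℤ) : Set ℕ :=
  {n | j ≤ (binaryDigitSum (n + t) : ℤ) - binaryDigitSum n}

theorem two_mul_mem_digitGainSet_two_mul (t n : ℕ) (j : ℤ) :
    2 * n ∈ digitGainSet (2 * t) j ↔ n ∈ digitGainSet t j := by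
  simp only [digitGainSet, Set.mem_ofPred_eq]
  rw [← mul_add, binaryDigitSum_two_mul, binaryDigitSum_two_mul]

theorem two_mul_add_one_mem_digitGainSet_two_mul (t n : ℕ) (j : ℤ) :
    2 * n + 1 ∈ digitGainSet (2 * t) j ↔ n ∈ digitGainSet t j := by
  simp only [digitGainSet, Set.mem_ofPred_eq]
  rw [show 2 * n + 1 + 2 * t = 2 * (n + t) + 1 by ring, binaryDigitSum_two_mul_add_one,
    binaryDigitSum_two_mul_add_one]
  push_cast
  constructor <;> intro h <;> linarith

theorem two_mul_mem_digitGainSet_two_mul_add_one (t n : ℕ) (j : ℤ) :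
    2 * n ∈ digitGainSet (2 * t + 1) j ↔ n ∈ digitGainSet t (j - 1) := by
  simp only [digitGainSet, Set.mem_ofPred_eq]
  rw [show 2 * n + (2 * t + 1) = 2 * (n + t) + 1 by ring, binaryDigitSum_two_mul_add_one,
    binaryDigitSum_two_mul]
  push_cast
  constructor <;> intro h <;> linarith

theorem two_mul_add_one_mem_digitGainSet_two_mul_add_one (t n : ℕ) (j : ℤ) :
    2 * n + 1 ∈ digitGainSet (2 * t + 1) j ↔ n ∈ digitGainSet (t + 1) (j + 1) := by
  simp only [digitGainSet, Set.mem_ofPred_eq]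
  rw [show 2 * n + 1 + (2 * t + 1) = 2 * (n + (t + 1)) by ring, binaryDigitSum_two_mul_add_one,
    binaryDigitSum_two_mul]
  push_cast
  constructor <;> intro h <;> linarith

/-- The number of elements of `A` below `N` splits according to parity. -/
theorem ncard_lt_eq_add_of_parity {A A₀ A₁ : Set ℕ} (h0 : ∀ n, 2 * n ∈ A ↔ n ∈ A₀)
    (h1 : ∀ n, 2 * n + 1 ∈ A ↔ n ∈ A₁) (N : ℕ) :
    {n | n < N ∧ n ∈ A}.ncard =
      {n | n < (N + 1) / 2 ∧ n ∈ A₀}.ncard + {n | n < N / 2 ∧ n ∈ A₁}.ncard := by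
  have hfin : ∀ (M : ℕ) (B : Set ℕ), {n | n < M ∧ n ∈ B}.Finite := fun M B =>
    (Set.finite_lt_nat M).subset fun n hn => hn.1
  have h2 : {n | n < N ∧ n ∈ A} = (fun n => 2 * n) '' {n | n < (N + 1) / 2 ∧ n ∈ A₀} ∪
      (fun n => 2 * n + 1) '' {n | n < N / 2 ∧ n ∈ A₁} := by
    ext n
    simp only [Set.mem_ofPred_eq, Set.mem_union, Set.mem_image]
    constructor
    · rintro ⟨hn, hA⟩
      rcases Nat.even_or_odd' n with ⟨m, rfl | rfl⟩
      · exact Or.inl ⟨m, ⟨by omega, (h0 m).1 hA⟩, rfl⟩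
      · exact Or.inr ⟨m, ⟨by omega, (h1 m).1 hA⟩, rfl⟩
    · rintro (⟨m, ⟨hm, hA⟩, rfl⟩ | ⟨m, ⟨hm, hA⟩, rfl⟩)
      · exact ⟨by omega, (h0 m).2 hA⟩
      · exact ⟨by omega, (h1 m).2 hA⟩
  rw [h2, Set.ncard_union_eq _ ((hfin _ _).image _) ((hfin _ _).image _),
    Set.ncard_image_of_injective _ (fun a b h => by simpa using h),
    Set.ncard_image_of_injective _ (fun a b h => by simpa using h)]
  rw [Set.disjoint_left]
  rintro _ ⟨a, -, rfl⟩ ⟨b, -, hb⟩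
  simp only at hb
  omega

theorem HasAsymptoticDensity.tendsto_half {A : Set ℕ} {d : ℝ} (h : HasAsymptoticDensity A d)
    (k : ℕ) (hk : k ≤ 1) :
    Filter.Tendsto (fun N : ℕ => (({n | n < (N + k) / 2 ∧ n ∈ A}.ncard : ℕ) : ℝ) / N)
      Filter.atTop (nhds (d / 2)) := by
  have h1 : Filter.Tendsto (fun N : ℕ => (N + k) / 2) Filter.atTop Filter.atTop :=
    Filter.tendsto_atTop_atTop.2 fun b => ⟨2 * b, fun a ha => by omega⟩
  have h2 := h.comp h1
  have h3 : Filter.Tendsto (fun N : ℕ => (((N + k) / 2 : ℕ) : ℝ) / N) Filter.atTop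
      (nhds (1 / 2)) := by
    have h4 : Filter.Tendsto (fun N : ℕ => (1 / 2 : ℝ) - (1 : ℝ) / N) Filter.atTop
        (nhds (1 / 2 - 0)) := tendsto_const_nhds.sub tendsto_one_div_atTop_nhds_zero_nat
    have h5 : Filter.Tendsto (fun N : ℕ => (1 / 2 : ℝ) + (1 : ℝ) / N) Filter.atTop
        (nhds (1 / 2 + 0)) := tendsto_const_nhds.add tendsto_one_div_atTop_nhds_zero_nat
    rw [sub_zero] at h4
    rw [add_zero] at h5
    refine tendsto_of_tendsto_of_tendsto_of_le_of_le' h4 h5 ?_ ?_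
    · filter_upwards [Filter.eventually_gt_atTop 0] with N hN
      have hN' : (0 : ℝ) < N := by exact_mod_cast hN
      have h6 : (N : ℝ) ≤ 2 * ((N + k) / 2 : ℕ) + 2 := by
        have : N ≤ 2 * ((N + k) / 2) + 2 := by omega
        exact_mod_cast this
      rw [le_div_iff₀ hN', sub_mul, one_div_mul_cancel hN'.ne']
      linarith
    · filter_upwards [Filter.eventually_gt_atTop 0] with N hN
      have hN' : (0 : ℝ) < N := by exact_mod_cast hN
      have h6 : 2 * (((N + k) / 2 : ℕ) : ℝ) ≤ N + 2 := by
        have : 2 * ((N + k) / 2) ≤ N + 2 := by omega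
        exact_mod_cast this
      rw [div_le_iff₀ hN', add_mul, one_div_mul_cancel hN'.ne']
      linarith
  have h4 := h2.mul h3
  rw [mul_one_div] at h4
  refine h4.congr' ?_
  filter_upwards [Filter.eventually_gt_atTop 1] with N hN
  have h5 : (((N + k) / 2 : ℕ) : ℝ) ≠ 0 := by
    have : (N + k) / 2 ≠ 0 := by omega
    exact_mod_cast this
  have h6 : (N : ℝ) ≠ 0 := by
    have : N ≠ 0 := by omega
    exact_mod_cast this
  simp only [Function.comp]
  field_simp

theorem HasAsymptoticDensity.of_parity {A A₀ A₁ : Set ℕ} {d₀ d₁ : ℝ}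
    (h0 : ∀ n, 2 * n ∈ A ↔ n ∈ A₀) (h1 : ∀ n, 2 * n + 1 ∈ A ↔ n ∈ A₁)
    (hd0 : HasAsymptoticDensity A₀ d₀) (hd1 : HasAsymptoticDensity A₁ d₁) :
    HasAsymptoticDensity A ((d₀ + d₁) / 2) := by
  have h := (hd0.tendsto_half 1 le_rfl).add (hd1.tendsto_half 0 zero_le_one)
  rw [← add_div] at h
  refine h.congr fun N => ?_
  rw [ncard_lt_eq_add_of_parity h0 h1 N, Nat.cast_add, add_div, add_zero]

theorem hasAsymptoticDensity_empty : HasAsymptoticDensity ∅ 0 := by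
  simp [HasAsymptoticDensity]

theorem hasAsymptoticDensity_univ : HasAsymptoticDensity Set.univ 1 := by
  refine tendsto_const_nhds.congr' ?_
  filter_upwards [Filter.eventually_gt_atTop 0] with N hN
  have h6 : (N : ℝ) ≠ 0 := by
    have : N ≠ 0 := by omega
    exact_mod_cast this
  have : {n : ℕ | n < N ∧ n ∈ Set.univ} = ((Finset.range N : Finset ℕ) : Set ℕ) := by
    ext; simp
  rw [this, Set.ncard_coe_finset, Finset.card_range, div_self h6]

theorem hasAsymptoticDensity_digitGainSet_zero (j : ℤ) :
    HasAsymptoticDensity (digitGainSet 0 j) ((1 + signedTail (charFn 0) j) / 2) := by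
  rw [signedTail_charFn_zero]
  split_ifs with h
  · have : digitGainSet 0 j = Set.univ := by ext; simp [digitGainSet, h]
    rw [this]
    convert hasAsymptoticDensity_univ
    norm_num
  · have : digitGainSet 0 j = ∅ := by ext; simp [digitGainSet]; omega
    rw [this]
    convert hasAsymptoticDensity_empty
    norm_num

/-- The recursion for t = 1 expresses level j through level j+1, so the induction runs downwards
from j = 2, where the set is empty because adding 1 raises the digit sum by at most 1. -/
theorem hasAsymptoticDensity_digitGainSet_one (j : ℤ) :
    HasAsymptoticDensity (digitGainSet 1 j) ((1 + signedTail (charFn 1) j) / 2) := by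
  have hbig : ∀ j : ℤ, 2 ≤ j →
      HasAsymptoticDensity (digitGainSet 1 j) ((1 + signedTail (charFn 1) j) / 2) := by
    intro j hj
    have : digitGainSet 1 j = ∅ := by
      ext n
      have := binaryDigitSum_succ_le n
      simp only [digitGainSet, Set.mem_ofPred_eq, Set.mem_empty_iff_false, iff_false]
      omega
    rw [this, signedTail_charFn_one_of_two_le hj]
    convert hasAsymptoticDensity_empty
    norm_num
  rcases le_total 2 j with hj | hj
  · exact hbig j hj
  · induction j, hj using Int.leInductionDown with
    | base => exact hbig 2 le_rfl
    | pred j hj ih =>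
      have h := HasAsymptoticDensity.of_parity
        (two_mul_mem_digitGainSet_two_mul_add_one 0 · (j - 1))
        (two_mul_add_one_mem_digitGainSet_two_mul_add_one 0 · (j - 1))
        (hasAsymptoticDensity_digitGainSet_zero (j - 1 - 1))
        (by rw [sub_add_cancel, zero_add]; exact ih)
      have h2 := signedTail_charFn_two_mul_add_one 0 (j - 1)
      rw [mul_zero, zero_add, sub_add_cancel] at h2
      rw [mul_zero, zero_add] at h
      rw [h2]
      convert h using 1
      ring

theorem hasAsymptoticDensity_digitGainSet (t : ℕ) (j : ℤ) :
    HasAsymptoticDensity (digitGainSet t j) ((1 + signedTail (charFn t) j) / 2) := by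
  induction t using dyadic_induction generalizing j with
  | h0 => exact hasAsymptoticDensity_digitGainSet_zero j
  | h1 => exact hasAsymptoticDensity_digitGainSet_one j
  | he t ih =>
    rw [signedTail_charFn_two_mul]
    convert HasAsymptoticDensity.of_parity (two_mul_mem_digitGainSet_two_mul t · j)
      (two_mul_add_one_mem_digitGainSet_two_mul t · j) (ih j) (ih j) using 1
    ring
  | ho t ih ih' =>
    rw [signedTail_charFn_two_mul_add_one]
    convert HasAsymptoticDensity.of_parity (two_mul_mem_digitGainSet_two_mul_add_one t · j)
      (two_mul_add_one_mem_digitGainSet_two_mul_add_one t · j) (ih (j - 1)) (ih' (j + 1)) using 1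
    ring

/-! ### Sums of centred geometric variables are balanced -/

section geomChar

open Complex

theorem norm_geomChar_le_one (θ : ℝ) : ‖geomChar θ‖ ≤ 1 := by
  rw [geomChar, norm_div, norm_exp_neg_ofReal_mul_I]
  refine div_le_one_of_le₀ ?_ (norm_nonneg _)
  have := norm_sub_norm_le 2 (exp (θ * I))
  rw [norm_exp_ofReal_mul_I, norm_ofNat] at this
  linarith

theorem norm_geomChar_pow_sub_one_le (m : ℕ) (θ : ℝ) :
    ‖geomChar θ ^ m - 1‖ ≤ (3 * m) * |θ| := by
  induction m with
  | zero => simp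
  | succ m ih =>
    have h1 : geomChar θ ^ (m + 1) - 1 = geomChar θ * (geomChar θ ^ m - 1) + (geomChar θ - 1) := by
      ring
    rw [h1]
    refine (norm_add_le _ _).trans ?_
    rw [norm_mul]
    have h2 := norm_geomChar_sub_one_le θ
    have h3 := mul_le_of_le_one_left (norm_nonneg (geomChar θ ^ m - 1)) (norm_geomChar_le_one θ)
    push_cast
    linarith

theorem hasDerivAt_exp_mul_I (θ : ℝ) :
    HasDerivAt (fun x : ℝ => exp (x * I)) (exp (θ * I) * I) θ := by
  simpa using ((hasDerivAt_id θ).ofReal_comp.mul_const I).cexp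

theorem hasDerivAt_geomChar (θ : ℝ) :
    HasDerivAt geomChar (2 * I * exp (θ * I) * (exp (θ * I) - 1) * geomChar θ ^ 2) θ := by
  have h1 := hasDerivAt_exp_mul_I θ
  have h2 : HasDerivAt (fun x : ℝ => exp (-(x * I))) (exp (-(θ * I)) * -I) θ := by
    simpa using ((hasDerivAt_id θ).ofReal_comp.mul_const I).neg.cexp
  have h0 := two_sub_exp_ne_zero θ
  have h3 := h2.div (h1.const_sub 2) h0
  refine h3.congr_deriv ?_
  have hee := exp_mul_exp_neg (θ * I)
  rw [geomChar]
  field_simp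
  linear_combination (-2 * exp (θ * I) + 2) * hee

theorem two_I_mul_sin_half (θ : ℝ) :
    2 * I * (Real.sin (θ / 2) : ℂ) =
      exp (((θ / 2 : ℝ) : ℂ) * I) - exp (-(((θ / 2 : ℝ) : ℂ) * I)) := by
  rw [ofReal_sin, Complex.sin]
  have := I_mul_I
  rw [neg_mul]
  linear_combination (exp (-(((θ / 2 : ℝ) : ℂ) * I)) - exp (((θ / 2 : ℝ) : ℂ) * I)) * this

theorem two_mul_cos_half (θ : ℝ) :
    2 * (Real.cos (θ / 2) : ℂ) =
      exp (((θ / 2 : ℝ) : ℂ) * I) + exp (-(((θ / 2 : ℝ) : ℂ) * I)) := by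
  rw [ofReal_cos, Complex.cos, neg_mul]
  ring

theorem tailIntegrand_zero_eq (f : ℝ → ℂ) (θ : ℝ) :
    tailIntegrand f 0 θ = (exp (((θ / 2 : ℝ) : ℂ) * I) * f θ).im / Real.sin (θ / 2) := by
  rw [tailIntegrand, Int.cast_zero, show (1 / 2 - 0) * θ = θ / 2 by ring]

theorem hasDerivAt_im {f : ℝ → ℂ} {f' : ℂ} {θ : ℝ} (h : HasDerivAt f f' θ) :
    HasDerivAt (fun x => (f x).im) f'.im θ :=
  (imCLM.hasFDerivAt (x := f θ)).comp_hasDerivAt θ h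

/-- After division by sin(θ/2) the integrand is, up to the constant 1/2 · 0, nothing but the
derivative of Im(-log(2 - exp(iθ))), and 2 - exp(iθ) is a positive real at both endpoints. -/
theorem signedTail_geomChar_pow_one : signedTail (fun θ => geomChar θ ^ 1) 0 = 0 := by
  have hpi := Real.pi_pos
  have hcont : Continuous fun θ : ℝ => (I * exp (θ * I) / (2 - exp (θ * I))).im :=
    continuous_im.comp (Continuous.div (by fun_prop) (by fun_prop) two_sub_exp_ne_zero)
  have h1 : ∫ θ in 0..Real.pi, tailIntegrand (fun θ => geomChar θ ^ 1) 0 θ =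
      ∫ θ in 0..Real.pi, (I * exp (θ * I) / (2 - exp (θ * I))).im := by
    refine intervalIntegral.integral_congr_ae (MeasureTheory.ae_of_all _ fun θ hθ => ?_)
    rw [Set.uIoc_of_le hpi.le] at hθ
    have hs : 0 < Real.sin (θ / 2) :=
      Real.sin_pos_of_pos_of_lt_pi (by linarith [hθ.1]) (by linarith [hθ.2])
    have h0 := two_sub_exp_ne_zero θ
    -- The cosine is real and drops out of the imaginary part; the remaining term carries the factor
    -- sin(θ/2) that cancels.
    have key : exp (((θ / 2 : ℝ) : ℂ) * I) * geomChar θ ^ 1 =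
        (I * exp (θ * I) / (2 - exp (θ * I))) * (Real.sin (θ / 2) : ℂ) +
          (Real.cos (θ / 2) : ℂ) := by
      have e1 := two_I_mul_sin_half θ
      have e2 := two_mul_cos_half θ
      rw [pow_one, geomChar, div_mul_eq_mul_div, mul_div_assoc', div_add' _ _ _ h0,
        div_left_inj' h0]
      have e3 : exp (((θ / 2 : ℝ) : ℂ) * I) * exp (-(θ * I)) =
          exp (-(((θ / 2 : ℝ) : ℂ) * I)) := by
        rw [← exp_add]; congr 1; push_cast; ring
      have e4 : exp (-(((θ / 2 : ℝ) : ℂ) * I)) * exp (θ * I) = exp (((θ / 2 : ℝ) : ℂ) * I) := by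
        rw [← exp_add]; congr 1; push_cast; ring
      linear_combination e3 - (exp (θ * I) / 2) * e1 - ((2 - exp (θ * I)) / 2) * e2 + e4
    rw [tailIntegrand_zero_eq, key, add_im, im_mul_ofReal, ofReal_im, add_zero,
      mul_div_cancel_right₀ _ hs.ne']
  have h2 : ∀ θ : ℝ, HasDerivAt (fun x : ℝ => (-log (2 - exp (x * I))).im)
      (I * exp (θ * I) / (2 - exp (θ * I))).im θ := by
    intro θ
    refine hasDerivAt_im ?_
    have h3 := (hasDerivAt_exp_mul_I θ).const_sub 2
    have h4 : 2 - exp (θ * I) ∈ slitPlane := by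
      left
      rw [sub_re, exp_ofReal_mul_I_re]
      have := Real.cos_le_one θ
      simp only [re_ofNat]
      linarith
    refine (h3.clog_real h4).neg.congr_deriv ?_
    ring
  rw [signedTail, h1, intervalIntegral.integral_eq_sub_of_hasDerivAt (fun θ _ => h2 θ)
    (hcont.intervalIntegrable _ _)]
  have h3 : (2 : ℂ) - exp (Real.pi * I) = ((3 : ℝ) : ℂ) := by
    rw [exp_pi_mul_I]; push_cast; norm_num
  have h4 : (2 : ℂ) - exp ((0 : ℝ) * I) = 1 := by simp; norm_num
  rw [h3, h4, ← ofReal_log (by norm_num), neg_im, ofReal_im]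
  simp

/-- The difference of the two integrands is the derivative of Im(`geomChar`^k / k), and `geomChar`
is real at 0 and at π. -/
theorem signedTail_geomChar_pow_succ {k : ℕ} (hk : 1 ≤ k) :
    signedTail (fun θ => geomChar θ ^ (k + 1)) 0 = signedTail (fun θ => geomChar θ ^ k) 0 := by
  have hpi := Real.pi_pos
  have hcg := continuous_geomChar
  have hcont : Continuous fun θ : ℝ =>
      (2 * I * exp (θ * I) * (exp (θ * I) - 1) * geomChar θ ^ (k + 1)).im :=
    continuous_im.comp (by fun_prop)
  have i1 := intervalIntegrable_tailIntegrand (f := fun θ => geomChar θ ^ (k + 1)) (by fun_prop)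
    (norm_geomChar_pow_sub_one_le (k + 1)) 0
  have i2 := intervalIntegrable_tailIntegrand (f := fun θ => geomChar θ ^ k) (by fun_prop)
    (norm_geomChar_pow_sub_one_le k) 0
  have h1 : ∫ θ in 0..Real.pi, (tailIntegrand (fun θ => geomChar θ ^ (k + 1)) 0 θ -
      tailIntegrand (fun θ => geomChar θ ^ k) 0 θ) =
      ∫ θ in 0..Real.pi,
        (2 * I * exp (θ * I) * (exp (θ * I) - 1) * geomChar θ ^ (k + 1)).im := by
    refine intervalIntegral.integral_congr_ae (MeasureTheory.ae_of_all _ fun θ hθ => ?_)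
    rw [Set.uIoc_of_le hpi.le] at hθ
    have hs : 0 < Real.sin (θ / 2) :=
      Real.sin_pos_of_pos_of_lt_pi (by linarith [hθ.1]) (by linarith [hθ.2])
    have key : exp (((θ / 2 : ℝ) : ℂ) * I) * geomChar θ ^ (k + 1) -
        exp (((θ / 2 : ℝ) : ℂ) * I) * geomChar θ ^ k =
        (2 * I * exp (θ * I) * (exp (θ * I) - 1) * geomChar θ ^ (k + 1)) *
          (Real.sin (θ / 2) : ℂ) := by
      have e1 := two_I_mul_sin_half θ
      have e2 : geomChar θ * (exp (θ * I) * (2 - exp (θ * I))) = 1 := by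
        have h0 := two_sub_exp_ne_zero θ
        have hee' := exp_mul_exp_neg (θ * I)
        rw [geomChar]
        field_simp
        linear_combination hee'
      have e4 : exp (-(((θ / 2 : ℝ) : ℂ) * I)) * exp (θ * I) = exp (((θ / 2 : ℝ) : ℂ) * I) := by
        rw [← exp_add]; congr 1; push_cast; ring
      rw [pow_succ]
      linear_combination (exp (((θ / 2 : ℝ) : ℂ) * I) * geomChar θ ^ k) * e2
        - (exp (θ * I) * (exp (θ * I) - 1) * geomChar θ ^ k * geomChar θ) * e1
        + ((exp (θ * I) - 1) * geomChar θ ^ k * geomChar θ) * e4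
    rw [tailIntegrand_zero_eq, tailIntegrand_zero_eq, ← sub_div, ← sub_im, key, im_mul_ofReal,
      mul_div_cancel_right₀ _ hs.ne']
  have h2 : ∀ θ : ℝ, HasDerivAt (fun x : ℝ => (geomChar x ^ k / k).im)
      (2 * I * exp (θ * I) * (exp (θ * I) - 1) * geomChar θ ^ (k + 1)).im θ := by
    intro θ
    refine hasDerivAt_im ?_
    refine (((hasDerivAt_geomChar θ).pow k).div_const (k : ℂ)).congr_deriv ?_
    have hk' : (k : ℂ) ≠ 0 := by
      have : k ≠ 0 := by omega
      exact_mod_cast this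
    obtain ⟨l, rfl⟩ : ∃ l, k = l + 1 := ⟨k - 1, by omega⟩
    simp only [Nat.add_sub_cancel]
    field_simp
    ring
  rw [← sub_eq_zero, signedTail, signedTail, ← mul_sub, ← intervalIntegral.integral_sub i1 i2, h1,
    intervalIntegral.integral_eq_sub_of_hasDerivAt (fun θ _ => h2 θ)
    (hcont.intervalIntegrable _ _)]
  have h3 : geomChar Real.pi = ((-1 / 3 : ℝ) : ℂ) := by
    rw [geomChar, exp_neg, exp_pi_mul_I]; push_cast; norm_num
  have h4 : geomChar 0 = ((1 : ℝ) : ℂ) := by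
    rw [geomChar]; simp; norm_num
  rw [h3, h4, ← ofReal_natCast, ← ofReal_pow, ← ofReal_pow, ← ofReal_div, ← ofReal_div, ofReal_im,
    ofReal_im]
  simp

/-- A sum of `m ≥ 1` independent copies of `G - 1`, with `G` geometrically distributed with
parameter `1/2`, is nonnegative with probability exactly `1/2`. -/
theorem signedTail_geomChar_pow {m : ℕ} (hm : 1 ≤ m) :
    signedTail (fun θ => geomChar θ ^ m) 0 = 0 := by
  induction m, hm using Nat.le_induction with
  | base => exact signedTail_geomChar_pow_one
  | succ k hk ih => rw [signedTail_geomChar_pow_succ hk, ih]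

end geomChar

/-! ### Log cosh and its fixed point -/

open Complex in
/-- The principal branch of `log ∘ cosh`. -/
noncomputable def logCosh (z : ℂ) : ℂ := log (cosh z)

open Complex in
/-- The logarithm of `geomChar`. -/
noncomputable def logGeom (θ : ℝ) : ℂ := -(θ * I) - log (2 - exp (θ * I))

section logCosh

open Complex

theorem norm_cosh_sub_one_le {z : ℂ} (hz : ‖z‖ ≤ 1) : ‖cosh z - 1‖ ≤ ‖z‖ ^ 2 := by
  have h1 := norm_exp_sub_one_sub_id_le hz
  have h2 := norm_exp_sub_one_sub_id_le (x := -z) (by rwa [norm_neg])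
  rw [norm_neg] at h2
  have h3 : cosh z - 1 = ((exp z - 1 - z) + (exp (-z) - 1 - -z)) / 2 := by rw [cosh]; ring
  rw [h3, norm_div, norm_ofNat]
  linarith [norm_add_le (exp z - 1 - z) (exp (-z) - 1 - -z)]

theorem norm_sinh_sub_self_le {z : ℂ} (hz : ‖z‖ ≤ 1) : ‖sinh z - z‖ ≤ ‖z‖ ^ 2 := by
  have h1 := norm_exp_sub_one_sub_id_le hz
  have h2 := norm_exp_sub_one_sub_id_le (x := -z) (by rwa [norm_neg])
  rw [norm_neg] at h2
  have h3 : sinh z - z = ((exp z - 1 - z) - (exp (-z) - 1 - -z)) / 2 := by rw [sinh]; ring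
  rw [h3, norm_div, norm_ofNat]
  linarith [norm_sub_le (exp z - 1 - z) (exp (-z) - 1 - -z)]

theorem three_quarters_le_re_cosh {z : ℂ} (hz : ‖z‖ ≤ 1 / 2) : 3 / 4 ≤ (cosh z).re := by
  have h1 := norm_cosh_sub_one_le (z := z) (by linarith)
  have h2 := abs_re_le_norm (cosh z - 1)
  rw [sub_re, one_re] at h2
  have h3 := (abs_le.1 h2).1
  nlinarith [norm_nonneg z]

theorem cosh_ne_zero_of_norm_le {z : ℂ} (hz : ‖z‖ ≤ 1 / 2) : cosh z ≠ 0 := by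
  intro h
  have := three_quarters_le_re_cosh hz
  rw [h, zero_re] at this
  linarith

theorem hasDerivAt_logCosh {z : ℂ} (hz : ‖z‖ ≤ 1 / 2) :
    HasDerivAt logCosh (sinh z / cosh z) z :=
  (hasDerivAt_cosh z).clog (Or.inl (by linarith [three_quarters_le_re_cosh hz]))

theorem norm_sinh_div_cosh_sub_self_le {z : ℂ} (hz : ‖z‖ ≤ 1 / 2) :
    ‖sinh z / cosh z - z‖ ≤ 2 * ‖z‖ ^ 2 := by
  have h0 := cosh_ne_zero_of_norm_le hz
  have h1 := norm_cosh_sub_one_le (z := z) (by linarith)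
  have h2 := norm_sinh_sub_self_le (z := z) (by linarith)
  have h3 : 3 / 4 ≤ ‖cosh z‖ := (three_quarters_le_re_cosh hz).trans (re_le_norm _)
  have h4 : sinh z / cosh z - z = ((sinh z - z) - z * (cosh z - 1)) / cosh z := by
    field_simp; ring
  rw [h4, norm_div, div_le_iff₀ (by linarith)]
  have h5 := norm_sub_le (sinh z - z) (z * (cosh z - 1))
  rw [norm_mul] at h5
  have h6 : ‖z‖ * ‖cosh z - 1‖ ≤ 1 / 2 * ‖z‖ ^ 2 := by gcongr
  nlinarith [sq_nonneg ‖z‖]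

/-- Mean value inequality for log cosh x - x^2/2, whose derivative tanh x - x is at most 2ρ^2 on the
disc. -/
theorem norm_logCosh_sub_logCosh_le {z w : ℂ} {ρ : ℝ} (hρ : ρ ≤ 1 / 2) (hz : ‖z‖ ≤ ρ)
    (hw : ‖w‖ ≤ ρ) :
    ‖logCosh z - logCosh w - (z ^ 2 - w ^ 2) / 2‖ ≤ 2 * ρ ^ 2 * ‖z - w‖ := by
  have h1 : ∀ x ∈ Metric.closedBall (0 : ℂ) ρ,
      HasDerivWithinAt (fun x => logCosh x - x ^ 2 / 2) (sinh x / cosh x - x)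
        (Metric.closedBall 0 ρ) x := by
    intro x hx
    rw [mem_closedBall_zero_iff] at hx
    have h2 := ((hasDerivAt_pow 2 x).div_const 2)
    refine ((hasDerivAt_logCosh (hx.trans hρ)).sub (h2.congr_deriv ?_)).hasDerivWithinAt
    simp
  have h2 : ∀ x ∈ Metric.closedBall (0 : ℂ) ρ, ‖sinh x / cosh x - x‖ ≤ 2 * ρ ^ 2 := by
    intro x hx
    rw [mem_closedBall_zero_iff] at hx
    refine (norm_sinh_div_cosh_sub_self_le (hx.trans hρ)).trans ?_
    gcongr
  have h3 := (convex_closedBall (0 : ℂ) ρ).norm_image_sub_le_of_norm_hasDerivWithin_le h1 h2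
    (mem_closedBall_zero_iff.2 hw) (mem_closedBall_zero_iff.2 hz)
  refine le_of_eq_of_le (congrArg norm ?_) h3
  ring

theorem logCosh_zero : logCosh 0 = 0 := by simp [logCosh]

theorem logCosh_neg (z : ℂ) : logCosh (-z) = logCosh z := by simp [logCosh]

theorem exp_logGeom (θ : ℝ) : exp (logGeom θ) = geomChar θ := by
  rw [logGeom, exp_sub, exp_log (two_sub_exp_ne_zero θ), geomChar]

theorem norm_logGeom_le_linear {θ : ℝ} (hθ : |θ| ≤ 1 / 1000) : ‖logGeom θ‖ ≤ 5 / 2 * |θ| := by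
  have h1 := norm_exp_sub_one_le θ
  rw [norm_sub_rev] at h1
  have h2 := norm_log_one_add_half_le_self (z := 1 - exp (θ * I)) (by linarith)
  rw [show (1 : ℂ) + (1 - exp (θ * I)) = 2 - exp (θ * I) by ring] at h2
  have h3 := norm_sub_le (-(θ * I)) (log (2 - exp (θ * I)))
  rw [norm_neg, norm_mul, norm_I, mul_one, norm_real, Real.norm_eq_abs] at h3
  rw [logGeom]
  linarith

/-- Appending a 1 maps the difference δ of consecutive logarithms to δ/2 - log cosh(δ/2 - iθ). The
identity says that δ = -`logGeom θ` is a fixed point of this map. -/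
theorem logCosh_logGeom {θ : ℝ} (hθ : |θ| ≤ 1 / 1000) :
    logCosh (-logGeom θ / 2 - θ * I) = logGeom θ / 2 := by
  have h0 := two_sub_exp_ne_zero θ
  have h1 : cosh (-logGeom θ / 2 - θ * I) = exp (logGeom θ / 2) := by
    have h2 : exp (-logGeom θ / 2 - θ * I) =
        exp (logGeom θ / 2) * (exp (-logGeom θ) * exp (-(θ * I))) := by
      rw [← exp_add, ← exp_add]; congr 1; ring
    have h3 : exp (-(-logGeom θ / 2 - θ * I)) = exp (logGeom θ / 2) * exp (θ * I) := by
      rw [← exp_add]; congr 1; ring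
    have h4 : exp (-logGeom θ) * exp (-(θ * I)) = 2 - exp (θ * I) := by
      rw [exp_neg (logGeom θ), exp_logGeom, geomChar, inv_div, div_mul_cancel₀]
      exact exp_ne_zero _
    rw [cosh, h2, h3, h4]
    ring
  have h5 := norm_logGeom_le_linear hθ
  have h6 := abs_im_le_norm (logGeom θ / 2)
  rw [norm_div, norm_ofNat] at h6
  have h7 := abs_le.1 (h6.trans (by linarith : ‖logGeom θ‖ / 2 ≤ 1))
  have h8 := Real.pi_gt_three
  rw [logCosh, h1, log_exp (by linarith) (by linarith)]

theorem norm_logGeom_bounds {θ : ℝ} (hθ : |θ| ≤ 1 / 1000) :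
    ‖logGeom θ‖ ≤ 6 * |θ| ^ 2 ∧ ‖logGeom θ + (θ : ℂ) ^ 2‖ ≤ 60 * |θ| ^ 3 := by
  have h0 := abs_nonneg θ
  have h1 := norm_logGeom_le_linear hθ
  have hθn : ‖(θ : ℂ) * I‖ = |θ| := by
    rw [norm_mul, norm_I, mul_one, norm_real, Real.norm_eq_abs]
  have h2 : ‖-logGeom θ / 2 - θ * I‖ ≤ 9 / 4 * |θ| := by
    refine (norm_sub_le _ _).trans ?_
    rw [norm_div, norm_neg, norm_ofNat, hθn]
    linarith
  have h3 := norm_logCosh_sub_logCosh_le (by linarith) h2 (w := 0) (by rw [norm_zero]; linarith)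
  rw [logCosh_logGeom hθ, logCosh_zero, sub_zero, sub_zero, zero_pow two_ne_zero, sub_zero] at h3
  set R := logGeom θ
  -- The fixed point equation is expanded to second order and the crude linear bound on R is then
  -- bootstrapped to R = O(θ^2) and R + θ^2 = O(θ^3).
  set E := R / 2 - (-R / 2 - θ * I) ^ 2 / 2 with hE
  have h4 : ‖E‖ ≤ 23 * |θ| ^ 3 := by
    refine h3.trans ?_
    calc 2 * (9 / 4 * |θ|) ^ 2 * ‖-R / 2 - θ * I‖ ≤ 2 * (9 / 4 * |θ|) ^ 2 * (9 / 4 * |θ|) := by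
          gcongr
      _ ≤ 23 * |θ| ^ 3 := by
          have : 0 ≤ |θ| ^ 3 := by positivity
          nlinarith
  have h5 : R + (θ : ℂ) ^ 2 = θ * I * R + R ^ 2 / 4 + 2 * E := by
    rw [hE]
    linear_combination ((θ : ℂ) ^ 2) * I_sq
  have h6 : ‖R + (θ : ℂ) ^ 2‖ ≤ |θ| * ‖R‖ + ‖R‖ ^ 2 / 4 + 46 * |θ| ^ 3 := by
    rw [h5]
    have h7 := norm_add_le (θ * I * R + R ^ 2 / 4) (2 * E)
    have h8 := norm_add_le (θ * I * R) (R ^ 2 / 4)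
    rw [norm_mul, hθn, norm_div, norm_pow, norm_ofNat] at h8
    rw [norm_mul, norm_ofNat] at h7
    linarith
  have h7 : |θ| ^ 3 ≤ |θ| ^ 2 / 1000 := by nlinarith [sq_nonneg |θ|]
  have h8 : |θ| ^ 4 ≤ |θ| ^ 3 / 1000 := by nlinarith [pow_nonneg h0 3]
  have h9 : ‖R‖ ≤ 6 * |θ| ^ 2 := by
    have h10 : ‖R‖ ≤ ‖R + (θ : ℂ) ^ 2‖ + |θ| ^ 2 := by
      have h11 := norm_sub_le (R + (θ : ℂ) ^ 2) ((θ : ℂ) ^ 2)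
      rwa [add_sub_cancel_right, norm_pow, norm_real, Real.norm_eq_abs] at h11
    have h12 : |θ| * ‖R‖ ≤ |θ| * (5 / 2 * |θ|) := by gcongr
    have h13 : ‖R‖ ^ 2 ≤ (5 / 2 * |θ|) ^ 2 := by gcongr
    nlinarith
  refine ⟨h9, h6.trans ?_⟩
  have h12 : |θ| * ‖R‖ ≤ |θ| * (6 * |θ| ^ 2) := by gcongr
  have h13 : ‖R‖ ^ 2 ≤ (6 * |θ| ^ 2) ^ 2 := by gcongr
  nlinarith

/-- The increment of `logCosh` from the fixed point `-R/2 - iθ`, `R = logGeom θ`. -/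
theorem norm_logCosh_increment_le {θ : ℝ} (hθ : |θ| ≤ 1 / 1000) {W : ℂ}
    (hW : ‖W‖ ≤ 3 * |θ| ^ 2) :
    ‖logCosh (-logGeom θ / 2 - θ * I + W / 2) - logGeom θ / 2 + θ * I / 2 * W‖ ≤
      4 * |θ| ^ 2 * ‖W‖ := by
  have h0 := abs_nonneg θ
  obtain ⟨hR, -⟩ := norm_logGeom_bounds hθ
  have hθn : ‖(θ : ℂ) * I‖ = |θ| := by
    rw [norm_mul, norm_I, mul_one, norm_real, Real.norm_eq_abs]
  have h7 : |θ| ^ 2 ≤ |θ| / 1000 := by nlinarith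
  have h1 : ‖-logGeom θ / 2 - θ * I‖ ≤ 11 / 10 * |θ| := by
    refine (norm_sub_le _ _).trans ?_
    rw [norm_div, norm_neg, norm_ofNat, hθn]
    linarith
  have h2 : ‖-logGeom θ / 2 - θ * I + W / 2‖ ≤ 6 / 5 * |θ| := by
    refine (norm_add_le _ _).trans ?_
    rw [norm_div, norm_ofNat]
    linarith
  have h3 := norm_logCosh_sub_logCosh_le (by linarith) h2
    (w := -logGeom θ / 2 - θ * I) (by linarith)
  rw [logCosh_logGeom hθ, add_sub_cancel_left, norm_div, norm_ofNat] at h3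
  set R := logGeom θ
  set z := -R / 2 - θ * I with hz
  have h4 : logCosh (z + W / 2) - R / 2 + θ * I / 2 * W =
      (logCosh (z + W / 2) - R / 2 - ((z + W / 2) ^ 2 - z ^ 2) / 2) +
        (W * W / 8 - W * R / 4) := by
    rw [hz]; ring
  rw [h4]
  have h5 := norm_add_le (logCosh (z + W / 2) - R / 2 - ((z + W / 2) ^ 2 - z ^ 2) / 2)
    (W * W / 8 - W * R / 4)
  have h6 := norm_sub_le (W * W / 8) (W * R / 4)
  rw [norm_div, norm_div, norm_mul, norm_mul, norm_ofNat, norm_ofNat] at h6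
  have h8 := mul_le_mul_of_nonneg_left hW (norm_nonneg W)
  have h9 := mul_le_mul_of_nonneg_left hR (norm_nonneg W)
  nlinarith [mul_nonneg (sq_nonneg |θ|) (norm_nonneg W)]

end logCosh

/-! ### Expansion of the logarithm to fourth order -/

open Complex in
/-- A logarithm of `charFn t θ`, valid for small `θ`. -/
noncomputable def logChar (t : ℕ) (θ : ℝ) : ℂ :=
  dyadicRec 0 (logGeom (-θ)) (fun _ x y => (x + y) / 2 + logCosh ((y - x) / 2 - θ * I)) t

section logChar

open Complex

theorem logChar_zero (θ : ℝ) : logChar 0 θ = 0 := dyadicRec_zero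

theorem logChar_one (θ : ℝ) : logChar 1 θ = logGeom (-θ) := dyadicRec_one

theorem logChar_two_mul (t : ℕ) (θ : ℝ) : logChar (2 * t) θ = logChar t θ := dyadicRec_two_mul t

theorem logChar_two_mul_add_one {θ : ℝ} (hθ : |θ| ≤ 1 / 1000) (t : ℕ) :
    logChar (2 * t + 1) θ = (logChar t θ + logChar (t + 1) θ) / 2 +
      logCosh ((logChar (t + 1) θ - logChar t θ) / 2 - θ * I) := by
  refine dyadicRec_two_mul_add_one
    (f := fun _ x y => (x + y) / 2 + logCosh ((y - x) / 2 - θ * I)) ?_ t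
  have h1 := logCosh_logGeom (θ := -θ) (by rwa [abs_neg])
  rw [← logCosh_neg] at h1
  have h2 : (logGeom (-θ) - 0) / 2 - θ * I = -(-logGeom (-θ) / 2 - (-θ : ℝ) * I) := by
    push_cast; ring
  simp only [h2, h1]
  ring

/-- The weight `e^{2/3}`, where `e = varStep t`. -/
noncomputable def stepWeight (t : ℕ) : ℝ := varStep t ^ (2 / 3 : ℝ)

theorem stepWeight_pos (t : ℕ) : 0 < stepWeight t := Real.rpow_pos_of_pos (varStep_pos t) _

theorem stepWeight_cube (t : ℕ) : stepWeight t ^ 3 = varStep t ^ 2 := by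
  rw [stepWeight, ← Real.rpow_natCast, ← Real.rpow_mul (varStep_pos t).le, ← Real.rpow_natCast]
  norm_num

theorem stepWeight_le (t : ℕ) : stepWeight t ≤ 2.6 := by
  refine le_of_pow_le_pow_left₀ three_ne_zero (by norm_num) ?_
  rw [stepWeight_cube]
  nlinarith [varStep_pos t, varStep_le t]

theorem varStep_le_stepWeight (t : ℕ) : varStep t ≤ 1.6 * stepWeight t := by
  have h1 := stepWeight_pos t
  refine le_of_pow_le_pow_left₀ three_ne_zero (by positivity) ?_
  rw [mul_pow, stepWeight_cube]
  nlinarith [varStep_pos t, varStep_le t, sq_nonneg (varStep t)]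

theorem le_stepWeight_two_mul (t : ℕ) : 1.58 ≤ stepWeight (2 * t) := by
  refine le_of_pow_le_pow_left₀ three_ne_zero (stepWeight_pos _).le ?_
  rw [stepWeight_cube, varStep_two_mul]
  nlinarith [varStep_pos t, varStep_le t]

/-- Appending a 1 multiplies the weight by 2^(-2/3) > 0.62. That this exceeds 1/2 leaves room for
the extra term in `norm_stepDeviation_le`; the weight e itself would leave none. -/
theorem le_stepWeight_two_mul_add_one (t : ℕ) :
    0.62 * stepWeight t ≤ stepWeight (2 * t + 1) := by
  refine le_of_pow_le_pow_left₀ three_ne_zero (stepWeight_pos _).le ?_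
  rw [stepWeight_cube, varStep_two_mul_add_one, mul_pow, stepWeight_cube]
  nlinarith [sq_nonneg (varStep t)]

/-- A form of Young's inequality: if w = e^(2/3) exceeded both summands, then w^2 < w^3·l^2 =
(e·l)^2 < w^2. -/
theorem stepWeight_le_add (t : ℕ) {l : ℝ} (hl : 0 < l) :
    stepWeight t ≤ l * varStep t + (l ^ 2)⁻¹ := by
  by_contra! h
  have he := varStep_pos t
  have hw := stepWeight_pos t
  have h3 := stepWeight_cube t
  have h1 : l * varStep t < stepWeight t := by
    have : 0 < (l ^ 2)⁻¹ := by positivity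
    linarith
  have h2 : (l ^ 2)⁻¹ < stepWeight t := by
    have : 0 < l * varStep t := by positivity
    linarith
  rw [inv_lt_iff_one_lt_mul₀ (by positivity)] at h2
  have h4 : (l * varStep t) ^ 2 < stepWeight t ^ 2 := by gcongr
  have h5 : stepWeight t ^ 2 * 1 < stepWeight t ^ 2 * (stepWeight t * l ^ 2) := by gcongr
  nlinarith

/-- The deviation of `logChar (t+1) - logChar t` from its second order expansion around the
fixed point `-logGeom`. -/
noncomputable def stepDeviation (t : ℕ) (θ : ℝ) : ℂ :=
  logChar (t + 1) θ - logChar t θ + logGeom θ + varStep t / 2 * (θ : ℂ) ^ 2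

theorem norm_step_add_logGeom_le {t : ℕ} {θ : ℝ} (hθ : |θ| ≤ 1 / 1000)
    (h : ‖stepDeviation t θ‖ ≤ 300 * |θ| ^ 3 * stepWeight t) :
    ‖logChar (t + 1) θ - logChar t θ + logGeom θ‖ ≤ 3 * |θ| ^ 2 ∧
      ‖logChar (t + 1) θ - logChar t θ + logGeom θ‖ ≤
        ‖stepDeviation t θ‖ + 0.8 * stepWeight t * |θ| ^ 2 := by
  have h0 := abs_nonneg θ
  have h1 : logChar (t + 1) θ - logChar t θ + logGeom θ =
      stepDeviation t θ - varStep t / 2 * (θ : ℂ) ^ 2 := by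
    rw [stepDeviation]; ring
  have h2 := norm_sub_le (stepDeviation t θ) (varStep t / 2 * (θ : ℂ) ^ 2)
  rw [norm_mul, norm_pow, norm_div, norm_real, norm_real, norm_ofNat, Real.norm_eq_abs,
    Real.norm_eq_abs, abs_of_pos (varStep_pos t), ← h1] at h2
  have h3 := varStep_le_stepWeight t
  have h4 := varStep_le t
  have h5 := stepWeight_le t
  have h6 := sq_nonneg |θ|
  constructor
  · have h7 : 300 * |θ| ^ 3 * stepWeight t ≤ 300 * (|θ| ^ 2 * (1 / 1000)) * 2.6 := by
      rw [pow_succ]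
      gcongr
      exact (stepWeight_pos t).le
    nlinarith
  · nlinarith

theorem norm_logCosh_step_le {t : ℕ} {θ : ℝ} (hθ : |θ| ≤ 1 / 1000)
    (h : ‖stepDeviation t θ‖ ≤ 300 * |θ| ^ 3 * stepWeight t) :
    ‖logCosh ((logChar (t + 1) θ - logChar t θ) / 2 - θ * I) - logGeom θ / 2 +
        θ * I / 2 * (logChar (t + 1) θ - logChar t θ + logGeom θ)‖ ≤
      4 * |θ| ^ 2 * ‖logChar (t + 1) θ - logChar t θ + logGeom θ‖ := by
  have h1 := norm_logCosh_increment_le hθ (norm_step_add_logGeom_le hθ h).1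
  convert h1 using 5
  ring

theorem norm_logCosh_step_sub_le {t : ℕ} {θ : ℝ} (hθ : |θ| ≤ 1 / 1000)
    (h : ‖stepDeviation t θ‖ ≤ 300 * |θ| ^ 3 * stepWeight t) :
    ‖logCosh ((logChar (t + 1) θ - logChar t θ) / 2 - θ * I) - logGeom θ / 2‖ ≤
      2 * |θ| ^ 3 * stepWeight t := by
  have h0 := abs_nonneg θ
  have h1 := norm_logCosh_step_le hθ h
  obtain ⟨-, h2⟩ := norm_step_add_logGeom_le hθ h
  set W := logChar (t + 1) θ - logChar t θ + logGeom θ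
  set d := logCosh ((logChar (t + 1) θ - logChar t θ) / 2 - θ * I) - logGeom θ / 2
  have h3 := norm_sub_le (d + θ * I / 2 * W) (θ * I / 2 * W)
  rw [add_sub_cancel_right, norm_mul, norm_div, norm_mul, norm_I, mul_one, norm_real,
    Real.norm_eq_abs, norm_ofNat] at h3
  have hw := stepWeight_pos t
  have h4 : ‖W‖ ≤ 1.1 * |θ| ^ 2 * stepWeight t := by
    have h7 : 300 * |θ| ^ 3 * stepWeight t ≤ 300 * (|θ| ^ 2 * (1 / 1000)) * stepWeight t := by
      rw [pow_succ]
      gcongr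
    nlinarith
  have h5 : 4 * |θ| ^ 2 * ‖W‖ ≤ 4 * (|θ| * (1 / 1000)) * ‖W‖ := by
    rw [sq]
    gcongr
  have h6 : |θ| * ‖W‖ ≤ |θ| * (1.1 * |θ| ^ 2 * stepWeight t) := by gcongr
  have h7 : 0 ≤ |θ| ^ 3 * stepWeight t := by positivity
  nlinarith

/-- Each digit halves the deviation and adds a term of size at most 2|θ|^3·w, where w is the old
weight; a digit 0 also adds `logGeom θ` + θ^2, at most 60|θ|^3. For a digit 1, 150 + 2 ≤ 300·0.62;
for a digit 0 the new weight is at least 1.58, which suffices. -/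
theorem norm_stepDeviation_le {θ : ℝ} (hθ : |θ| ≤ 1 / 1000) (t : ℕ) :
    ‖stepDeviation t θ‖ ≤ 300 * |θ| ^ 3 * stepWeight t := by
  have h3 : 0 ≤ |θ| ^ 3 := by positivity
  obtain ⟨-, hR⟩ := norm_logGeom_bounds hθ
  induction t using digit_induction with
  | h0 =>
    obtain ⟨-, hR'⟩ := norm_logGeom_bounds (θ := -θ) (by rwa [abs_neg])
    rw [abs_neg, ofReal_neg, neg_sq] at hR'
    have h1 : stepDeviation 0 θ =
        (logGeom θ + (θ : ℂ) ^ 2) + (logGeom (-θ) + (θ : ℂ) ^ 2) := by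
      rw [stepDeviation, zero_add, logChar_zero, logChar_one, varStep_zero]
      push_cast
      ring
    have h2 := le_stepWeight_two_mul 0
    rw [mul_zero] at h2
    rw [h1]
    refine (norm_add_le _ _).trans ?_
    nlinarith
  | he t ih =>
    have h1 := norm_logCosh_step_sub_le hθ ih
    set d := logCosh ((logChar (t + 1) θ - logChar t θ) / 2 - θ * I) - logGeom θ / 2 with hd
    have h2 : stepDeviation (2 * t) θ =
        stepDeviation t θ / 2 + (logGeom θ + (θ : ℂ) ^ 2) + d := by
      rw [stepDeviation, stepDeviation, logChar_two_mul_add_one hθ, logChar_two_mul,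
        varStep_two_mul, hd]
      push_cast
      ring
    rw [h2]
    have h4 := norm_add_le (stepDeviation t θ / 2 + (logGeom θ + (θ : ℂ) ^ 2)) d
    have h5 := norm_add_le (stepDeviation t θ / 2) (logGeom θ + (θ : ℂ) ^ 2)
    rw [norm_div, norm_ofNat] at h5
    have h6 := le_stepWeight_two_mul t
    have h7 := stepWeight_le t
    nlinarith
  | ho t ih =>
    have h1 := norm_logCosh_step_sub_le hθ ih
    set d := logCosh ((logChar (t + 1) θ - logChar t θ) / 2 - θ * I) - logGeom θ / 2 with hd
    have h2 : stepDeviation (2 * t + 1) θ = stepDeviation t θ / 2 - d := by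
      rw [stepDeviation, stepDeviation, show 2 * t + 1 + 1 = 2 * (t + 1) by ring,
        logChar_two_mul_add_one hθ, logChar_two_mul,
        varStep_two_mul_add_one, hd]
      push_cast
      ring
    rw [h2]
    have h5 := norm_sub_le (stepDeviation t θ / 2) d
    rw [norm_div, norm_ofNat] at h5
    have h6 := le_stepWeight_two_mul_add_one t
    have h7 := stepWeight_pos t
    have h8 : |θ| ^ 3 * (0.62 * stepWeight t) ≤ |θ| ^ 3 * stepWeight (2 * t + 1) := by gcongr
    have h9 : 0 ≤ |θ| ^ 3 * stepWeight t := by positivity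
    nlinarith

theorem exp_logChar {θ : ℝ} (hθ : |θ| ≤ 1 / 1000) (t : ℕ) :
    exp (logChar t θ) = charFn t θ := by
  induction t using dyadic_induction with
  | h0 => rw [logChar_zero, charFn_zero, exp_zero]
  | h1 => rw [logChar_one, charFn_one, exp_logGeom]
  | he t ih => rw [logChar_two_mul, charFn_two_mul, ih]
  | ho t ih ih' =>
    have h0 := abs_nonneg θ
    have hz : ‖(logChar (t + 1) θ - logChar t θ) / 2 - θ * I‖ ≤ 1 / 2 := by
      have h1 := (norm_step_add_logGeom_le hθ (norm_stepDeviation_le hθ t)).1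
      have h2 := (norm_logGeom_bounds hθ).1
      have h3 := norm_sub_le (logChar (t + 1) θ - logChar t θ + logGeom θ) (logGeom θ)
      rw [add_sub_cancel_right] at h3
      have h4 := norm_sub_le ((logChar (t + 1) θ - logChar t θ) / 2) (θ * I)
      rw [norm_div, norm_ofNat, norm_mul, norm_I, mul_one, norm_real, Real.norm_eq_abs] at h4
      nlinarith
    rw [logChar_two_mul_add_one hθ, charFn_two_mul_add_one, exp_add, logCosh,
      exp_log (cosh_ne_zero_of_norm_le hz), cosh, ← ih, ← ih', mul_div_assoc', mul_add,
      ← exp_add, ← exp_add, ← exp_add, ← exp_add]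
    congr 1
    rw [add_comm]
    congr 2 <;> ring

/-- The error of the approximation of `logChar t` by a multiple of `logGeom`, corrected by the
third order term. -/
noncomputable def logError (t : ℕ) (θ : ℝ) : ℂ :=
  logChar t θ - digitVar t / 2 * logGeom θ - I * (skewDefect t / 6) * (θ : ℂ) ^ 3

/-- The first order term -(iθ/2)W of log cosh at the fixed point, with W = -(e/2)θ^2 plus the
deviation, yields iθ^3·e/4, which is the increment 3e/2 of `skewDefect` divided by 6. Only θ times
the deviation and O(θ^2 W) remain. -/
theorem norm_logError_two_mul_add_one_sub_le {θ : ℝ} (hθ : |θ| ≤ 1 / 1000) (t : ℕ) :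
    ‖logError (2 * t + 1) θ - (logError t θ + logError (t + 1) θ) / 2‖ ≤
      200 * |θ| ^ 4 * stepWeight t := by
  have h0 := abs_nonneg θ
  have hY := norm_stepDeviation_le hθ t
  have h1 := norm_logCosh_step_le hθ hY
  have h2 := (norm_step_add_logGeom_le hθ hY).2
  have hw := stepWeight_pos t
  have h3 : logError (2 * t + 1) θ - (logError t θ + logError (t + 1) θ) / 2 =
      (logCosh ((logChar (t + 1) θ - logChar t θ) / 2 - θ * I) - logGeom θ / 2 +
        θ * I / 2 * (logChar (t + 1) θ - logChar t θ + logGeom θ)) -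
        θ * I / 2 * stepDeviation t θ := by
    rw [logError, logError, logError, logChar_two_mul_add_one hθ, digitVar_two_mul_add_one,
      skewDefect_two_mul_add_one, stepDeviation]
    push_cast
    ring
  rw [h3]
  refine (norm_sub_le _ _).trans ?_
  rw [norm_mul, norm_div, norm_mul, norm_I, mul_one, norm_real, Real.norm_eq_abs, norm_ofNat]
  have h4 : ‖logChar (t + 1) θ - logChar t θ + logGeom θ‖ ≤ 1.1 * |θ| ^ 2 * stepWeight t := by
    have h7 : 300 * |θ| ^ 3 * stepWeight t ≤ 300 * (|θ| ^ 2 * (1 / 1000)) * stepWeight t := by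
      rw [pow_succ]
      gcongr
    nlinarith
  have h5 : 4 * |θ| ^ 2 * ‖logChar (t + 1) θ - logChar t θ + logGeom θ‖ ≤
      4 * |θ| ^ 2 * (1.1 * |θ| ^ 2 * stepWeight t) := by gcongr
  have h6 : |θ| / 2 * ‖stepDeviation t θ‖ ≤ |θ| / 2 * (300 * |θ| ^ 3 * stepWeight t) := by gcongr
  have h7 : 0 ≤ |θ| ^ 4 * stepWeight t := by positivity
  nlinarith

/-- Along the recursion `skewDefect` gains at least `varStep` and `digitVar` gains 1, so they absorb
the two summands of `stepWeight_le_add` respectively. -/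
theorem norm_logError_le {θ : ℝ} (hθ : |θ| ≤ 1 / 1000) {l : ℝ} (hl : 0 < l) (t : ℕ) :
    ‖logError t θ‖ ≤ 200 * |θ| ^ 4 * (l * skewDefect t + (l ^ 2)⁻¹ * digitVar t) := by
  have h4 : 0 ≤ |θ| ^ 4 := by positivity
  have hstep : ∀ t, ‖logError (2 * t + 1) θ - (logError t θ + logError (t + 1) θ) / 2‖ ≤
      200 * |θ| ^ 4 * (l * varStep t + (l ^ 2)⁻¹) := fun t =>
    (norm_logError_two_mul_add_one_sub_le hθ t).trans (by gcongr; exact stepWeight_le_add t hl)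
  have hz : logError 0 θ = 0 := by
    rw [logError, logChar_zero, digitVar_zero, skewDefect_zero]; simp
  induction t using dyadic_induction with
  | h0 => rw [hz, skewDefect_zero, digitVar_zero]; simp
  | h1 =>
    have h1 := hstep 0
    rw [mul_zero, zero_add, hz, zero_add, varStep_zero, sub_half, norm_div, norm_ofNat] at h1
    rw [skewDefect_one, digitVar_one]
    have h5 : 0 ≤ |θ| ^ 4 * l := by positivity
    linarith
  | he t ih =>
    rwa [logError, logChar_two_mul, digitVar_two_mul, skewDefect_two_mul]
  | ho t ih ih' =>
    have h1 := hstep t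
    have h2 := norm_add_le (logError (2 * t + 1) θ - (logError t θ + logError (t + 1) θ) / 2)
      ((logError t θ + logError (t + 1) θ) / 2)
    rw [sub_add_cancel, norm_div, norm_ofNat] at h2
    have h3 := norm_add_le (logError t θ) (logError (t + 1) θ)
    rw [skewDefect_two_mul_add_one, digitVar_two_mul_add_one]
    have h5 : 0 ≤ |θ| ^ 4 * (l * varStep t) := by
      have := varStep_pos t
      positivity
    linarith

theorem charFn_eq_exp {θ : ℝ} (hθ : |θ| ≤ 1 / 1000) (t : ℕ) :
    charFn t θ = exp (digitVar t / 2 * logGeom θ) *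
      exp (I * (skewDefect t / 6) * (θ : ℂ) ^ 3 + logError t θ) := by
  rw [← exp_logChar hθ, ← exp_add, logError]
  congr 1
  ring

end logChar

/-! ### Comparison with the reference law near 0 -/

open Complex in
/-- The mixture of `geomChar ^ m` and `geomChar ^ (m+1)`, `m = ⌊A/2⌋`, of variance `A`. -/
noncomputable def refChar (A θ : ℝ) : ℂ :=
  ((1 - (A / 2 - ⌊A / 2⌋₊) : ℝ) : ℂ) * geomChar θ ^ ⌊A / 2⌋₊ +
    ((A / 2 - ⌊A / 2⌋₊ : ℝ) : ℂ) * geomChar θ ^ (⌊A / 2⌋₊ + 1)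

section comparison

open Complex

theorem norm_exp_sub_one_le_mul_exp (x : ℂ) : ‖exp x - 1‖ ≤ ‖x‖ * Real.exp ‖x‖ := by
  simpa using norm_exp_sub_sum_le_norm_mul_exp x 1

theorem norm_exp_sub_one_sub_self_le_mul_exp (x : ℂ) :
    ‖exp x - 1 - x‖ ≤ ‖x‖ ^ 2 * Real.exp ‖x‖ := by
  simpa [Finset.sum_range_succ, sub_sub] using norm_exp_sub_sum_le_norm_mul_exp x 2

theorem mul_exp_neg_le (u : ℝ) : u * Real.exp (-(u / 8)) ≤ 8 := by
  have h1 := Real.add_one_le_exp (u / 8)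
  have h2 : Real.exp (u / 8) * Real.exp (-(u / 8)) = 1 := by
    rw [← Real.exp_add, add_neg_cancel, Real.exp_zero]
  have h3 := Real.exp_pos (-(u / 8))
  nlinarith

theorem re_logGeom_le {θ : ℝ} (hθ : |θ| ≤ 1 / 1000) : (logGeom θ).re ≤ -(0.94 * θ ^ 2) := by
  have h1 := (norm_logGeom_bounds hθ).2
  have h2 := (re_le_norm (logGeom θ + (θ : ℂ) ^ 2)).trans h1
  rw [add_re, ← ofReal_pow, ofReal_re, pow_succ |θ| 2, sq_abs] at h2
  nlinarith [sq_nonneg θ]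

theorem norm_exp_mul_logGeom_le {θ : ℝ} (hθ : |θ| ≤ 1 / 1000) {c : ℝ} (hc : 0 ≤ c) :
    ‖exp (c * logGeom θ)‖ ≤ Real.exp (-(0.94 * c * θ ^ 2)) := by
  rw [norm_exp, re_ofReal_mul]
  refine Real.exp_le_exp.2 ?_
  nlinarith [re_logGeom_le hθ]

theorem exp_half_le_two {x : ℝ} (hx : x ≤ 1 / 2) : Real.exp x ≤ 2 := by
  have h1 := Real.exp_one_lt_d9
  have h2 : Real.exp x ≤ Real.exp (1 / 2) := Real.exp_le_exp.2 hx
  have h3 : Real.exp (1 / 2) * Real.exp (1 / 2) = Real.exp 1 := by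
    rw [← Real.exp_add]; norm_num
  nlinarith [Real.exp_pos (1 / 2)]

/-- A/2 need not be an integer. Interpolating linearly between the two neighbouring integer powers
agrees with the true power to first order in `logGeom θ`, so the error is of order θ^4. -/
theorem norm_exp_mul_logGeom_sub_refChar_le {θ A : ℝ} (hθ : |θ| ≤ 1 / 1000) (hA : 0 ≤ A) :
    ‖exp (((A / 2 : ℝ) : ℂ) * logGeom θ) - refChar A θ‖ ≤
      150 * θ ^ 4 * Real.exp (-(A * θ ^ 2 / 8)) := by
  rw [refChar]
  set m := ⌊A / 2⌋₊
  set p := A / 2 - m with hp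
  have hm : (m : ℝ) ≤ A / 2 := Nat.floor_le (by positivity)
  have hm' : A / 2 < m + 1 := Nat.lt_floor_add_one _
  have hp0 : 0 ≤ p := by linarith
  have hp1 : p ≤ 1 := by linarith
  have hR := (norm_logGeom_bounds hθ).1
  have hg := exp_logGeom θ
  set R := logGeom θ
  have hθ2 : |θ| ^ 2 ≤ 1 / 1000 := by nlinarith [abs_nonneg θ]
  have hR1 : ‖R‖ ≤ 1 := by linarith
  have h1 : exp (((A / 2 : ℝ) : ℂ) * R) = geomChar θ ^ m * exp (p * R) := by
    rw [← hg, ← exp_nat_mul, ← exp_add]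
    congr 1
    rw [hp]
    push_cast
    ring
  have hpR : ‖(p : ℂ) * R‖ ≤ ‖R‖ := by
    rw [norm_mul, norm_real, Real.norm_eq_abs, abs_of_nonneg hp0]
    exact mul_le_of_le_one_left (norm_nonneg _) hp1
  have h2 : exp (((A / 2 : ℝ) : ℂ) * R) - (((1 - p : ℝ) : ℂ) * geomChar θ ^ m +
      (p : ℂ) * geomChar θ ^ (m + 1)) =
      geomChar θ ^ m * ((exp (p * R) - 1 - p * R) - p * (exp R - 1 - R)) := by
    rw [h1, pow_succ, hg]
    push_cast
    ring
  have h3 := norm_exp_sub_one_sub_id_le (hpR.trans hR1)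
  have h4 := norm_exp_sub_one_sub_id_le hR1
  have h5 : ‖(exp (p * R) - 1 - p * R) - p * (exp R - 1 - R)‖ ≤ 72 * θ ^ 4 := by
    refine (norm_sub_le _ _).trans ?_
    rw [norm_mul, norm_real, Real.norm_eq_abs, abs_of_nonneg hp0]
    have h6 := mul_le_of_le_one_left (norm_nonneg (exp R - 1 - R)) hp1
    have h7 : ‖(p : ℂ) * R‖ ^ 2 ≤ ‖R‖ ^ 2 := by gcongr
    have h8 : ‖R‖ ^ 2 ≤ (6 * |θ| ^ 2) ^ 2 := by gcongr
    rw [sq_abs] at h8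
    nlinarith
  have h6 : ‖geomChar θ ^ m‖ ≤ 2 * Real.exp (-(A * θ ^ 2 / 8)) := by
    rw [← hg, ← exp_nat_mul, ← ofReal_natCast]
    refine (norm_exp_mul_logGeom_le hθ (Nat.cast_nonneg m)).trans ?_
    have h7 : -(0.94 * m * θ ^ 2) ≤ θ ^ 2 + -(A * θ ^ 2 / 8) := by
      nlinarith [sq_nonneg θ]
    refine (Real.exp_le_exp.2 h7).trans ?_
    rw [Real.exp_add]
    gcongr
    refine exp_half_le_two ?_
    rw [sq_abs] at hθ2
    linarith
  rw [h2, norm_mul]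
  calc ‖geomChar θ ^ m‖ * ‖(exp (p * R) - 1 - p * R) - p * (exp R - 1 - R)‖ ≤
      (2 * Real.exp (-(A * θ ^ 2 / 8))) * (72 * θ ^ 4) := by gcongr
    _ ≤ _ := by
      have : 0 ≤ Real.exp (-(A * θ ^ 2 / 8)) * θ ^ 4 := by positivity
      linarith

/-- Write `charFn` as G·exp(x), where x is the cubic term plus `logError`. The error consists of
G·`logError`, the quadratic remainder of exp(x), and G - `refChar`. Factors Aθ^2 are absorbed by
part of the Gaussian. -/
theorem norm_charFn_sub_refChar_sub_le {θ : ℝ} (hθ0 : 0 < θ) (hθ : θ ≤ 1 / 1000) {t : ℕ}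
    (ht : 1 ≤ t) {l : ℝ} (hl : 1 ≤ l) :
    ‖charFn t θ - refChar (digitVar t) θ - exp (((digitVar t / 2 : ℝ) : ℂ) * logGeom θ) *
        (((skewDefect t / 6 * θ ^ 3 : ℝ) : ℂ) * I)‖ ≤
      250 * (l * skewDefect t + (l ^ 2)⁻¹ * digitVar t) * θ ^ 4 *
        Real.exp (-(digitVar t * θ ^ 2 / 8)) := by
  have habs : |θ| = θ := abs_of_pos hθ0
  have hθ' : |θ| ≤ 1 / 1000 := by rwa [habs]
  have hD := skewDefect_ge t ht
  have hDA := skewDefect_le t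
  have hA := digitVar_nonneg t
  have hU1 := norm_logError_le hθ' one_pos t
  have hUl := norm_logError_le hθ' (by linarith : 0 < l) t
  have hG := norm_exp_mul_logGeom_le hθ' (by positivity : 0 ≤ digitVar t / 2)
  have href := norm_exp_mul_logGeom_sub_refChar_le hθ' hA
  have hγ := charFn_eq_exp hθ' t
  rw [habs] at hU1 hUl
  rw [one_pow, inv_one, one_mul, one_mul] at hU1
  set A := digitVar t
  set D := skewDefect t
  set U := logError t θ
  set Q := l * D + (l ^ 2)⁻¹ * A with hQ
  set G := exp (((A / 2 : ℝ) : ℂ) * logGeom θ)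
  set x := ((D / 6 * θ ^ 3 : ℝ) : ℂ) * I + U with hx
  have hDQ : D ≤ Q := by
    have h1 : 0 ≤ (l ^ 2)⁻¹ * A := by positivity
    nlinarith
  have hγ' : charFn t θ = G * exp x := by
    rw [hγ, hx]
    simp only [G]
    push_cast
    congr 2
    ring
  have hθ3 : θ ^ 4 ≤ θ ^ 3 * (1 / 1000) := by rw [pow_succ]; gcongr
  have hθ2 : θ ^ 3 ≤ θ ^ 2 * (1 / 1000) := by rw [pow_succ]; gcongr
  have hxn : ‖x‖ ≤ D / 6 * θ ^ 3 + ‖U‖ := by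
    refine (norm_add_le _ _).trans ?_
    rw [norm_mul, norm_I, mul_one, norm_real, Real.norm_eq_abs, abs_of_nonneg (by positivity)]
  have hx1 : ‖x‖ ≤ 2.4 * A * θ ^ 3 := by
    have h1 : θ ^ 4 * (D + A) ≤ θ ^ 4 * (7 * A) := by gcongr; linarith
    have h2 : A * θ ^ 4 ≤ A * (θ ^ 3 * (1 / 1000)) := by gcongr
    have h3 : D * θ ^ 3 ≤ 6 * A * θ ^ 3 := by gcongr
    nlinarith
  have hx2 : ‖x‖ ≤ 0.01 * A * θ ^ 2 := by
    have h2 : A * θ ^ 3 ≤ A * (θ ^ 2 * (1 / 1000)) := by gcongr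
    have h3 : 0 ≤ A * θ ^ 2 := by positivity
    nlinarith
  -- One factor is bounded through A and the other through Q, so that the result is linear in Q.
  have hxx : ‖x‖ ^ 2 ≤ A * θ ^ 2 * Q * θ ^ 4 := by
    have h1 : D / 6 * θ ^ 3 + ‖U‖ ≤ 0.4 * Q * θ ^ 3 := by
      have h2 : Q * θ ^ 4 ≤ Q * (θ ^ 3 * (1 / 1000)) := by gcongr
      have h3 : D * θ ^ 3 ≤ Q * θ ^ 3 := by gcongr
      have h4 : 0 ≤ Q * θ ^ 3 := mul_nonneg (by linarith) (by positivity)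
      nlinarith
    calc ‖x‖ ^ 2 = ‖x‖ * ‖x‖ := sq _
      _ ≤ (2.4 * A * θ ^ 3) * (0.4 * Q * θ ^ 3) := by
        gcongr
        exact hxn.trans h1
      _ = 0.96 * (A * θ ^ 2 * Q * θ ^ 4) := by ring
      _ ≤ A * θ ^ 2 * Q * θ ^ 4 := by
        have : 0 ≤ A * θ ^ 2 * Q * θ ^ 4 := by
          have : 0 ≤ Q := by linarith
          positivity
        linarith
  set e := Real.exp (-(A * θ ^ 2 / 8)) with he
  have hepos : 0 < e := Real.exp_pos _
  have hQ0 : 0 ≤ Q := by linarith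
  have hGe : ‖G‖ ≤ e := by
    refine hG.trans (Real.exp_le_exp.2 ?_)
    have : 0 ≤ A * θ ^ 2 := by positivity
    linarith
  have hGx : ‖G‖ * Real.exp ‖x‖ ≤ e * e := by
    calc ‖G‖ * Real.exp ‖x‖ ≤ Real.exp (-(0.94 * (A / 2) * θ ^ 2)) *
        Real.exp (0.01 * A * θ ^ 2) := by gcongr
      _ ≤ e * e := by
        rw [he, ← Real.exp_add, ← Real.exp_add]
        refine Real.exp_le_exp.2 ?_
        have : 0 ≤ A * θ ^ 2 := by positivity
        linarith
  have hu := mul_exp_neg_le (A * θ ^ 2)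
  have hsplit : charFn t θ - refChar A θ - G * (((D / 6 * θ ^ 3 : ℝ) : ℂ) * I) =
      G * U + G * (exp x - 1 - x) + (G - refChar A θ) := by
    rw [hγ', hx]
    ring
  have h1 : ‖G * U‖ ≤ 200 * Q * θ ^ 4 * e := by
    rw [norm_mul]
    calc ‖G‖ * ‖U‖ ≤ e * (200 * θ ^ 4 * Q) := by gcongr
      _ = _ := by ring
  have h2 : ‖G * (exp x - 1 - x)‖ ≤ 8 * Q * θ ^ 4 * e := by
    rw [norm_mul]
    calc ‖G‖ * ‖exp x - 1 - x‖ ≤ ‖G‖ * (‖x‖ ^ 2 * Real.exp ‖x‖) := by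
          gcongr
          exact norm_exp_sub_one_sub_self_le_mul_exp x
      _ = (‖G‖ * Real.exp ‖x‖) * ‖x‖ ^ 2 := by ring
      _ ≤ (e * e) * (A * θ ^ 2 * Q * θ ^ 4) := by gcongr
      _ = (A * θ ^ 2 * e) * (Q * θ ^ 4 * e) := by ring
      _ ≤ 8 * (Q * θ ^ 4 * e) := by gcongr
      _ = _ := by ring
  rw [hsplit]
  have h3 := norm_add_le (G * U + G * (exp x - 1 - x)) (G - refChar A θ)
  have h4 := norm_add_le (G * U) (G * (exp x - 1 - x))
  have h5 : 150 * θ ^ 4 * e ≤ 13 * Q * θ ^ 4 * e := by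
    gcongr
    linarith
  have h6 : 0 ≤ Q * θ ^ 4 * e := by positivity
  linarith

theorem exp_sub_le_re_exp_mul {θ A : ℝ} (hθ0 : 0 < θ) (hθ : θ ≤ 1 / 1000) (hA : 0 ≤ A) :
    Real.exp (-(A * θ ^ 2 / 2)) - 500 * θ * Real.exp (-(A * θ ^ 2 / 8)) ≤
      (exp (((θ / 2 : ℝ) : ℂ) * I) * exp (((A / 2 : ℝ) : ℂ) * logGeom θ)).re := by
  have habs : |θ| = θ := abs_of_pos hθ0
  have hR := (norm_logGeom_bounds (θ := θ) (by rwa [habs])).2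
  rw [habs] at hR
  set R := logGeom θ
  set v : ℂ := ((θ / 2 : ℝ) : ℂ) * I + ((A / 2 : ℝ) : ℂ) * (R + (θ : ℂ) ^ 2) with hv
  have hvn : ‖v‖ ≤ θ / 2 + 30 * A * θ ^ 3 := by
    refine (norm_add_le _ _).trans ?_
    rw [norm_mul, norm_I, mul_one, norm_real, Real.norm_eq_abs, abs_of_nonneg (by positivity),
      norm_mul, norm_real, Real.norm_eq_abs, abs_of_nonneg (by positivity)]
    have : A / 2 * ‖R + (θ : ℂ) ^ 2‖ ≤ A / 2 * (60 * θ ^ 3) := by gcongr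
    linarith
  have hθ2 : A * θ ^ 3 ≤ A * (θ ^ 2 * (1 / 1000)) := by rw [pow_succ θ 2]; gcongr
  have hprod : exp (((θ / 2 : ℝ) : ℂ) * I) * exp (((A / 2 : ℝ) : ℂ) * R) =
      ((Real.exp (-(A * θ ^ 2 / 2)) : ℝ) : ℂ) * exp v := by
    rw [ofReal_exp, ← exp_add, ← exp_add, hv]
    congr 1
    push_cast
    ring
  set e := Real.exp (-(A * θ ^ 2 / 8)) with he
  have hepos : 0 < e := Real.exp_pos _
  have hexp : Real.exp (-(A * θ ^ 2 / 2)) * Real.exp ‖v‖ ≤ 2 * (e * e) := by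
    calc Real.exp (-(A * θ ^ 2 / 2)) * Real.exp ‖v‖ ≤
        Real.exp (θ / 2) * Real.exp (-(A * θ ^ 2 / 4)) := by
          rw [← Real.exp_add, ← Real.exp_add]
          refine Real.exp_le_exp.2 ?_
          have : 0 ≤ A * θ ^ 2 := by positivity
          linarith
      _ ≤ 2 * (e * e) := by
          have hee : e * e = Real.exp (-(A * θ ^ 2 / 4)) := by
            rw [he, ← Real.exp_add]; congr 1; ring
          rw [hee]
          gcongr
          exact exp_half_le_two (by linarith)
  have hu := mul_exp_neg_le (A * θ ^ 2)
  have herr : Real.exp (-(A * θ ^ 2 / 2)) * ‖exp v - 1‖ ≤ 500 * θ * e := by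
    calc Real.exp (-(A * θ ^ 2 / 2)) * ‖exp v - 1‖ ≤
        Real.exp (-(A * θ ^ 2 / 2)) * (‖v‖ * Real.exp ‖v‖) := by
          gcongr
          exact norm_exp_sub_one_le_mul_exp v
      _ = (Real.exp (-(A * θ ^ 2 / 2)) * Real.exp ‖v‖) * ‖v‖ := by ring
      _ ≤ (2 * (e * e)) * (θ / 2 + 30 * A * θ ^ 3) := by gcongr
      _ = θ * e * (e + 60 * (A * θ ^ 2 * e)) := by ring
      _ ≤ θ * e * (1 + 60 * 8) := by
          gcongr
          exact Real.exp_le_one_iff.2 (by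
            have : 0 ≤ A * θ ^ 2 := by positivity
            linarith)
      _ ≤ 500 * θ * e := by
          have : 0 ≤ θ * e := by positivity
          linarith
  rw [hprod, re_ofReal_mul]
  have h1 := (abs_le.1 (abs_re_le_norm (exp v - 1))).1
  rw [sub_re, one_re] at h1
  have h2 := Real.exp_pos (-(A * θ ^ 2 / 2))
  nlinarith

/-- The integrand of `signedTail (charFn t) 0 - signedTail (refChar A) 0` is bounded from below
near `0`. -/
theorem le_im_div_sin_half {θ : ℝ} (hθ0 : 0 < θ) (hθ : θ ≤ 1 / 1000) {t : ℕ}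
    (ht : 1 ≤ t) {l : ℝ} (hl : 1 ≤ l) :
    skewDefect t / 3 * (θ ^ 2 * Real.exp (-(digitVar t * θ ^ 2 / 2))) -
      1300 * (l * skewDefect t + (l ^ 2)⁻¹ * digitVar t) *
        (θ ^ 3 * Real.exp (-(digitVar t * θ ^ 2 / 8))) ≤
      (exp (((θ / 2 : ℝ) : ℂ) * I) * (charFn t θ - refChar (digitVar t) θ)).im /
        Real.sin (θ / 2) := by
  have hD := skewDefect_ge t ht
  have hA := digitVar_nonneg t
  have h1 := norm_charFn_sub_refChar_sub_le hθ0 hθ ht hl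
  have h2 := exp_sub_le_re_exp_mul hθ0 hθ hA
  set A := digitVar t
  set D := skewDefect t
  set Q := l * D + (l ^ 2)⁻¹ * A with hQ
  have hDQ : D ≤ Q := by
    have h1 : 0 ≤ (l ^ 2)⁻¹ * A := by positivity
    nlinarith
  set h := exp (((θ / 2 : ℝ) : ℂ) * I)
  set G := exp (((A / 2 : ℝ) : ℂ) * logGeom θ)
  set E := charFn t θ - refChar A θ - G * (((D / 6 * θ ^ 3 : ℝ) : ℂ) * I) with hE
  set e := Real.exp (-(A * θ ^ 2 / 8))
  set e2 := Real.exp (-(A * θ ^ 2 / 2))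
  have hepos : 0 < e := Real.exp_pos _
  have he2pos : 0 < e2 := Real.exp_pos _
  have h3 : h * (charFn t θ - refChar A θ) = ((D / 6 * θ ^ 3 : ℝ) : ℂ) * (h * G * I) + h * E := by
    rw [hE]; ring
  have h4 : (h * (charFn t θ - refChar A θ)).im = D / 6 * θ ^ 3 * (h * G).re + (h * E).im := by
    rw [h3, add_im, im_ofReal_mul, mul_I_im]
  have h5 : -(250 * Q * θ ^ 4 * e) ≤ (h * E).im := by
    have h6 := abs_im_le_norm (h * E)
    rw [norm_mul, norm_exp_ofReal_mul_I, one_mul] at h6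
    linarith [(abs_le.1 (h6.trans h1)).1]
  have h6 : D / 6 * θ ^ 3 * (e2 - 500 * θ * e) ≤ D / 6 * θ ^ 3 * (h * G).re := by gcongr
  have hθpi : θ ≤ Real.pi := by linarith [Real.pi_gt_three]
  have hs1 := div_pi_le_sin_half hθ0.le hθpi
  have hs2 : Real.sin (θ / 2) ≤ θ / 2 := Real.sin_le (by positivity)
  have hs0 : 0 < Real.sin (θ / 2) := lt_of_lt_of_le (by positivity) hs1
  have hs3 : θ ≤ 3.2 * Real.sin (θ / 2) := by
    rw [div_le_iff₀ Real.pi_pos] at hs1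
    nlinarith [Real.pi_lt_d2]
  rw [le_div_iff₀ hs0, h4]
  have h7 : D / 3 * (θ ^ 2 * e2) * Real.sin (θ / 2) ≤ D / 3 * (θ ^ 2 * e2) * (θ / 2) := by gcongr
  have h8 : Q * (θ ^ 3 * e) * θ ≤ Q * (θ ^ 3 * e) * (3.2 * Real.sin (θ / 2)) := by
    have : 0 ≤ Q := by linarith
    gcongr
  have h9 : D * (θ ^ 4 * e) ≤ Q * (θ ^ 4 * e) := by gcongr
  have h10 : 0 ≤ Q * (θ ^ 4 * e) := mul_nonneg (by linarith) (by positivity)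
  nlinarith

end comparison

/-! ### Integration and positivity -/

section positivity_of_tail

open Complex

theorem norm_geomChar_le_exp {θ : ℝ} (hθ : |θ| ≤ Real.pi) :
    ‖geomChar θ‖ ≤ Real.exp (-(θ ^ 2 / 100)) := by
  have hpi : Real.pi ^ 2 ≤ 10 := by nlinarith [Real.pi_pos, Real.pi_lt_d2]
  have hpi' : 0 < Real.pi ^ 2 := by positivity
  have hsq : θ ^ 2 ≤ Real.pi ^ 2 := by
    rw [← sq_abs]; gcongr
  have hcos : Real.cos θ ≤ 1 - θ ^ 2 / 5 := by
    have h1 := Real.cos_le_one_sub_mul_cos_sq hθ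
    have h2 : 1 / 5 ≤ 2 / Real.pi ^ 2 := by
      rw [div_le_div_iff₀ (by norm_num) hpi']; linarith
    nlinarith [sq_nonneg θ]
  have hn : ‖2 - exp (θ * I)‖ ^ 2 = 5 - 4 * Real.cos θ := by
    have h1 : 2 - exp (θ * I) =
        ((2 - Real.cos θ : ℝ) : ℂ) + ((-Real.sin θ : ℝ) : ℂ) * I := by
      rw [exp_mul_I]; push_cast; ring
    rw [h1, ← normSq_eq_norm_sq, normSq_add_mul_I]
    nlinarith [Real.sin_sq_add_cos_sq θ]
  have h1 : 1 - θ ^ 2 / 50 ≤ Real.exp (-(θ ^ 2 / 50)) := by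
    linarith [Real.add_one_le_exp (-(θ ^ 2 / 50))]
  have h2 : Real.exp (-(θ ^ 2 / 100)) ^ 2 = Real.exp (-(θ ^ 2 / 50)) := by
    rw [← Real.exp_nat_mul]; congr 1; push_cast; ring
  refine le_of_sq_le_sq ?_ (Real.exp_pos _).le
  rw [h2, geomChar, norm_div, norm_exp_neg_ofReal_mul_I, div_pow, one_pow, hn,
    div_le_iff₀ (by nlinarith [sq_nonneg θ])]
  have h3 : (1 - θ ^ 2 / 50) * (1 + 4 / 5 * θ ^ 2) ≤
      Real.exp (-(θ ^ 2 / 50)) * (5 - 4 * Real.cos θ) := by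
    gcongr
    linarith
  nlinarith [sq_nonneg θ]

theorem norm_refChar_le {θ A : ℝ} (hθ : |θ| ≤ Real.pi) (hA : 4 ≤ A) :
    ‖refChar A θ‖ ≤ Real.exp (-(θ ^ 2 / 240) * (A - 4)) := by
  have hm : (⌊A / 2⌋₊ : ℝ) ≤ A / 2 := Nat.floor_le (by positivity)
  have hm' : A / 2 < ⌊A / 2⌋₊ + 1 := Nat.lt_floor_add_one _
  rw [refChar]
  set m := ⌊A / 2⌋₊
  set p := A / 2 - m with hp
  have hg1 := norm_geomChar_le_one θ
  have hgm : ‖geomChar θ ^ m‖ ≤ Real.exp (-(θ ^ 2 / 240) * (A - 4)) := by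
    rw [norm_pow]
    calc ‖geomChar θ‖ ^ m ≤ Real.exp (-(θ ^ 2 / 100)) ^ m := by
          gcongr
          exact norm_geomChar_le_exp hθ
      _ ≤ _ := by
          rw [← Real.exp_nat_mul]
          refine Real.exp_le_exp.2 ?_
          nlinarith [sq_nonneg θ]
  have hgm1 : ‖geomChar θ ^ (m + 1)‖ ≤ ‖geomChar θ ^ m‖ := by
    rw [pow_succ, norm_mul]
    exact mul_le_of_le_one_right (norm_nonneg _) hg1
  refine (norm_add_le _ _).trans ?_
  rw [norm_mul, norm_mul, norm_real, norm_real, Real.norm_eq_abs, Real.norm_eq_abs,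
    abs_of_nonneg (by linarith : 0 ≤ p), abs_of_nonneg (by linarith : 0 ≤ 1 - p)]
  nlinarith

/-- The integrand of `signedTail (charFn t) 0 - signedTail (refChar (digitVar t)) 0`. -/
noncomputable def comparisonIntegrand (t : ℕ) (θ : ℝ) : ℝ :=
  (exp (((θ / 2 : ℝ) : ℂ) * I) * (charFn t θ - refChar (digitVar t) θ)).im / Real.sin (θ / 2)

theorem comparisonIntegrand_eq (t : ℕ) : comparisonIntegrand t = fun θ =>
    tailIntegrand (charFn t) 0 θ -
    ((1 - (digitVar t / 2 - ⌊digitVar t / 2⌋₊)) *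
      tailIntegrand (fun θ => geomChar θ ^ ⌊digitVar t / 2⌋₊) 0 θ +
    (digitVar t / 2 - ⌊digitVar t / 2⌋₊) *
      tailIntegrand (fun θ => geomChar θ ^ (⌊digitVar t / 2⌋₊ + 1)) 0 θ) := by
  funext θ
  rw [comparisonIntegrand, tailIntegrand_zero_eq, tailIntegrand_zero_eq, tailIntegrand_zero_eq,
    mul_div_assoc', mul_div_assoc', ← add_div, ← sub_div, refChar]
  congr 1
  rw [← im_ofReal_mul, ← im_ofReal_mul, ← add_im, ← sub_im]
  congr 1
  ring

/-- The reference contributes nothing, both powers being balanced; variance at least 2 ensures that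
the smaller exponent is at least 1. -/
theorem comparisonIntegrand_integral {t : ℕ} (ht : 2 ≤ digitVar t) :
    IntervalIntegrable (comparisonIntegrand t) MeasureTheory.volume 0 Real.pi ∧
      ∫ θ in 0..Real.pi, comparisonIntegrand t θ = Real.pi * signedTail (charFn t) 0 := by
  obtain ⟨C, hC⟩ := exists_norm_charFn_sub_one_le t
  have hcg := continuous_geomChar
  have hm : 1 ≤ ⌊digitVar t / 2⌋₊ := Nat.le_floor (by push_cast; linarith)
  have i0 := intervalIntegrable_tailIntegrand (continuous_charFn t) hC 0
  have i1 := (intervalIntegrable_tailIntegrand (f := fun θ => geomChar θ ^ ⌊digitVar t / 2⌋₊)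
    (by fun_prop) (norm_geomChar_pow_sub_one_le _) 0).const_mul
      (1 - (digitVar t / 2 - ⌊digitVar t / 2⌋₊))
  have i2 := (intervalIntegrable_tailIntegrand
    (f := fun θ => geomChar θ ^ (⌊digitVar t / 2⌋₊ + 1))
    (by fun_prop) (norm_geomChar_pow_sub_one_le _) 0).const_mul
      (digitVar t / 2 - ⌊digitVar t / 2⌋₊)
  have hpi := Real.pi_pos.ne'
  have j1 := signedTail_geomChar_pow hm
  have j2 := signedTail_geomChar_pow (m := ⌊digitVar t / 2⌋₊ + 1) (by omega)
  rw [signedTail, mul_eq_zero_iff_left (inv_ne_zero hpi)] at j1 j2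
  rw [comparisonIntegrand_eq]
  refine ⟨i0.sub (i1.add i2), ?_⟩
  rw [intervalIntegral.integral_sub i0 (i1.add i2), intervalIntegral.integral_add i1 i2,
    intervalIntegral.integral_const_mul, intervalIntegral.integral_const_mul, j1, j2, signedTail,
    mul_inv_cancel_left₀ hpi]
  ring

theorem integral_cube_mul_exp_le {A b : ℝ} (hA : 0 < A) :
    ∫ θ in 0..b, θ ^ 3 * Real.exp (-(A * θ ^ 2 / 8)) ≤ 32 / A ^ 2 := by
  have h1 : ∀ θ : ℝ, HasDerivAt
      (fun x : ℝ => -((4 * x ^ 2 / A + 32 / A ^ 2) * Real.exp (-(A * x ^ 2 / 8))))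
      (θ ^ 3 * Real.exp (-(A * θ ^ 2 / 8))) θ := by
    intro θ
    have e1 : HasDerivAt (fun x : ℝ => 4 * x ^ 2 / A + 32 / A ^ 2) (8 * θ / A) θ := by
      refine ((((hasDerivAt_pow 2 θ).const_mul 4).div_const A).add_const _).congr_deriv ?_
      push_cast; ring
    have e2 : HasDerivAt (fun x : ℝ => -(A * x ^ 2 / 8)) (-(A * θ / 4)) θ := by
      refine ((((hasDerivAt_pow 2 θ).const_mul A).div_const 8).neg).congr_deriv ?_
      push_cast; ring
    refine ((e1.mul e2.exp).neg).congr_deriv ?_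
    field_simp
    ring
  rw [intervalIntegral.integral_eq_sub_of_hasDerivAt (fun θ _ => h1 θ)
    ((by fun_prop : Continuous fun θ : ℝ =>
      θ ^ 3 * Real.exp (-(A * θ ^ 2 / 8))).intervalIntegrable _ _)]
  have h2 : 0 ≤ (4 * b ^ 2 / A + 32 / A ^ 2) * Real.exp (-(A * b ^ 2 / 8)) := by positivity
  simp
  linarith

/-- Here σ is the Gaussian scale A^(-1/2); on [σ, 2σ] the exponential is at least exp(-2) ≥ 1/8. -/
theorem le_integral_sq_mul_exp {A σ b : ℝ} (hσ : 0 < σ) (hA : A * σ ^ 2 = 1) (hb : 2 * σ ≤ b) :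
    σ ^ 3 / 8 ≤ ∫ θ in 0..b, θ ^ 2 * Real.exp (-(A * θ ^ 2 / 2)) := by
  have hcont : Continuous fun θ : ℝ => θ ^ 2 * Real.exp (-(A * θ ^ 2 / 2)) := by fun_prop
  have hA0 : 0 < A := by
    by_contra! h
    nlinarith [sq_nonneg σ]
  have h1 : ∫ θ in σ..(2 * σ), θ ^ 2 * Real.exp (-(A * θ ^ 2 / 2)) ≤
      ∫ θ in 0..b, θ ^ 2 * Real.exp (-(A * θ ^ 2 / 2)) := by
    refine intervalIntegral.integral_mono_interval hσ.le (by linarith) hb ?_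
      (hcont.intervalIntegrable _ _)
    exact MeasureTheory.ae_of_all _ fun θ => by simp only [Pi.zero_apply]; positivity
  have h2 : ∫ _ in σ..(2 * σ), σ ^ 2 / 8 ≤
      ∫ θ in σ..(2 * σ), θ ^ 2 * Real.exp (-(A * θ ^ 2 / 2)) := by
    refine intervalIntegral.integral_mono_on (by linarith)
      (continuous_const.intervalIntegrable _ _) (hcont.intervalIntegrable _ _) ?_
    intro θ hθ
    have h3 : Real.exp (-2) ≤ Real.exp (-(A * θ ^ 2 / 2)) := by
      refine Real.exp_le_exp.2 ?_
      have : θ ^ 2 ≤ (2 * σ) ^ 2 := by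
        have := hθ.2
        have : 0 ≤ θ := by linarith [hθ.1]
        gcongr
      nlinarith
    have h4 : 1 / 8 ≤ Real.exp (-2) := by
      have h5 := Real.exp_one_lt_d9
      have h6 : Real.exp 1 * Real.exp 1 = Real.exp 2 := by rw [← Real.exp_add]; norm_num
      rw [Real.exp_neg, ← one_div]
      refine one_div_le_one_div_of_le (Real.exp_pos _) ?_
      nlinarith [Real.exp_pos 1]
    calc σ ^ 2 / 8 = σ ^ 2 * (1 / 8) := by ring
      _ ≤ θ ^ 2 * Real.exp (-(A * θ ^ 2 / 2)) := by
        gcongr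
        · exact hθ.1
        · exact h4.trans h3
  rw [intervalIntegral.integral_const, smul_eq_mul] at h2
  calc σ ^ 3 / 8 = (2 * σ - σ) * (σ ^ 2 / 8) := by ring
    _ ≤ _ := h2.trans h1

theorem le_integral_comparisonIntegrand_left {t : ℕ} (ht : 1 ≤ t) (hA : 2 ≤ digitVar t) {l σ : ℝ}
    (hl : 1 ≤ l) (hσ : 0 < σ) (hAσ : digitVar t * σ ^ 2 = 1) (hσ' : σ ≤ 1 / 2000) :
    skewDefect t * σ ^ 3 / 24 - 41600 * (l * skewDefect t + (l ^ 2)⁻¹ * digitVar t) /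
      digitVar t ^ 2 ≤ ∫ θ in 0..(1 / 1000), comparisonIntegrand t θ := by
  have hD := skewDefect_ge t ht
  have hi := (comparisonIntegrand_integral hA).1
  set A := digitVar t
  set D := skewDefect t
  set Q := l * D + (l ^ 2)⁻¹ * A with hQ
  have hQ0 : 0 ≤ Q := by positivity
  have c1 : Continuous fun θ : ℝ => D / 3 * (θ ^ 2 * Real.exp (-(A * θ ^ 2 / 2))) := by fun_prop
  have c2 : Continuous fun θ : ℝ => 1300 * Q * (θ ^ 3 * Real.exp (-(A * θ ^ 2 / 8))) := by
    fun_prop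
  have hmono : ∫ θ in (0 : ℝ)..(1 / 1000), (D / 3 * (θ ^ 2 * Real.exp (-(A * θ ^ 2 / 2))) -
      1300 * Q * (θ ^ 3 * Real.exp (-(A * θ ^ 2 / 8)))) ≤
      ∫ θ in 0..(1 / 1000), comparisonIntegrand t θ := by
    refine intervalIntegral.integral_mono_on (by norm_num)
      ((c1.sub c2).intervalIntegrable _ _) (hi.mono_set ?_) ?_
    · have := Real.pi_gt_three
      rw [Set.uIcc_of_le (by norm_num), Set.uIcc_of_le (by linarith)]
      exact Set.Icc_subset_Icc_right (by linarith)
    · intro θ hθ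
      rcases hθ.1.eq_or_lt with rfl | h0
      -- At θ = 0 the quotient by sin 0 has the default value 0, and the lower bound vanishes too.
      · simp [comparisonIntegrand]
      · exact le_im_div_sin_half h0 hθ.2 ht hl
  rw [intervalIntegral.integral_sub (c1.intervalIntegrable _ _) (c2.intervalIntegrable _ _),
    intervalIntegral.integral_const_mul, intervalIntegral.integral_const_mul] at hmono
  refine le_trans ?_ hmono
  have h1 := le_integral_sq_mul_exp (b := 1 / 1000) hσ hAσ (by linarith)
  have h2 := integral_cube_mul_exp_le (b := 1 / 1000) (by linarith : 0 < A)
  have h3 : D / 3 * (σ ^ 3 / 8) ≤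
      D / 3 * ∫ θ in (0 : ℝ)..(1 / 1000), θ ^ 2 * Real.exp (-(A * θ ^ 2 / 2)) := by gcongr
  have h4 : 1300 * Q * ∫ θ in (0 : ℝ)..(1 / 1000), θ ^ 3 * Real.exp (-(A * θ ^ 2 / 8)) ≤
      1300 * Q * (32 / A ^ 2) := by gcongr
  have h5 : 1300 * Q * (32 / A ^ 2) = 41600 * Q / A ^ 2 := by ring
  linarith

/-- For θ ≥ 1/1000 both characteristic functions decay at rate θ^2/240 ≥ 1/240000000. -/
theorem abs_integral_comparisonIntegrand_right_le {t : ℕ} (hA : 4 ≤ digitVar t) :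
    |∫ θ in (1 / 1000)..Real.pi, comparisonIntegrand t θ| ≤
      20000 * Real.exp (-((digitVar t - 4) / 240000000)) := by
  have hpi3 := Real.pi_gt_three
  have hpi : Real.pi ^ 2 ≤ 10 := by nlinarith [Real.pi_lt_d2]
  set E := Real.exp (-((digitVar t - 4) / 240000000)) with hE
  have hE0 : 0 < E := Real.exp_pos _
  have h1 : ‖∫ θ in (1 / 1000)..Real.pi, comparisonIntegrand t θ‖ ≤
      Real.pi * (2000 * E) * |Real.pi - 1 / 1000| := by
    refine intervalIntegral.norm_integral_le_of_norm_le_const fun θ hθ => ?_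
    rw [Set.uIoc_of_le (by linarith)] at hθ
    have hθ0 : 0 < θ := by linarith [hθ.1]
    have habs : |θ| ≤ Real.pi := by rw [abs_of_pos hθ0]; exact hθ.2
    refine abs_im_div_sin_half_le hθ0 hθ.2 ?_
    rw [norm_mul, norm_exp_ofReal_mul_I, one_mul]
    have h2 : Real.exp (-(θ ^ 2 / 240) * (digitVar t - 4)) ≤ E := by
      refine Real.exp_le_exp.2 ?_
      have : (1 / 1000) ^ 2 ≤ θ ^ 2 := by
        have := hθ.1.le
        gcongr
      nlinarith
    have h3 := norm_sub_le (charFn t θ) (refChar (digitVar t) θ)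
    have h4 := norm_charFn_le habs t
    have h5 := norm_refChar_le habs hA
    nlinarith [hθ.1]
  rw [Real.norm_eq_abs, abs_of_pos (by linarith : 0 < Real.pi - 1 / 1000)] at h1
  refine h1.trans ?_
  nlinarith

theorem exists_signedTail_charFn_pos :
    ∃ A₀ : ℝ, ∀ t : ℕ, A₀ ≤ digitVar t → 0 < signedTail (charFn t) 0 := by
  have hlim : Filter.Tendsto (fun A : ℝ => A ^ 2 * Real.exp (-((A - 4) / 240000000)))
      Filter.atTop (nhds 0) := by
    have h1 := (Real.tendsto_pow_mul_exp_neg_atTop_nhds_zero 2).comp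
      (Filter.tendsto_id.atTop_div_const (by norm_num : (0 : ℝ) < 240000000))
    have h2 := h1.const_mul (240000000 ^ 2 * Real.exp (4 / 240000000))
    rw [mul_zero] at h2
    refine h2.congr fun A => ?_
    simp only [Function.comp, id]
    rw [show -((A - 4) / 240000000) = 4 / 240000000 + -(A / 240000000) by ring, Real.exp_add]
    ring
  obtain ⟨A₁, hA₁⟩ := Filter.eventually_atTop.1
    (hlim.eventually (gt_mem_nhds (by norm_num : (0 : ℝ) < 1 / 200000)))
  refine ⟨max A₁ ((10 ^ 7) ^ 8), fun t ht => ?_⟩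
  have hA1 := hA₁ (digitVar t) ((le_max_left _ _).trans ht)
  have hA2 : (10 ^ 7) ^ 8 ≤ digitVar t := (le_max_right _ _).trans ht
  have ht1 : 1 ≤ t := by
    rcases Nat.eq_zero_or_pos t with rfl | h
    · rw [digitVar_zero] at hA2; norm_num at hA2
    · exact h
  -- With A = s^8 the main term is D·s^(-12)/24. For l = s^3 = A^(3/8) the error is a constant times
  -- s^(-12)(D/s + 1/s^2); the exponent 3/8 lies between 1/4 and 1/2, the limits within which both
  -- parts are small.
  obtain ⟨s, hs0, hs⟩ : ∃ s : ℝ, 0 ≤ s ∧ s ^ 8 = digitVar t :=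
    ⟨digitVar t ^ (1 / 8 : ℝ), Real.rpow_nonneg (digitVar_nonneg t) _, by
      rw [← Real.rpow_natCast, ← Real.rpow_mul (digitVar_nonneg t)]; norm_num⟩
  have hs7 : 10 ^ 7 ≤ s := by
    rw [← hs] at hA2
    exact le_of_pow_le_pow_left₀ (by norm_num) hs0 hA2
  have hA4 : 4 ≤ digitVar t := le_trans (by norm_num) hA2
  have hD := skewDefect_ge t ht1
  have hs1 : 1 ≤ s := le_trans (by norm_num) hs7
  have hspos : 0 < s := by linarith
  have hs4 : 2000 ≤ s ^ 4 := by
    calc (2000 : ℝ) ≤ (10 ^ 7) ^ 4 := by norm_num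
      _ ≤ s ^ 4 := by gcongr
  have hleft := le_integral_comparisonIntegrand_left ht1 (by linarith) (l := s ^ 3)
    (σ := (s ^ 4)⁻¹) (one_le_pow₀ hs1) (by positivity) (by rw [← hs]; field_simp) (by
      rw [← one_div]; exact one_div_le_one_div_of_le (by norm_num) hs4)
  have hright := (abs_le.1 (abs_integral_comparisonIntegrand_right_le hA4)).1
  obtain ⟨hi, hint⟩ := comparisonIntegrand_integral (t := t) (by linarith)
  have hpi3 := Real.pi_gt_three
  have hsplit := intervalIntegral.integral_add_adjacent_intervals
    (hi.mono_set (c := 0) (d := 1 / 1000) (by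
      rw [Set.uIcc_of_le (by norm_num), Set.uIcc_of_le (by linarith)]
      exact Set.Icc_subset_Icc_right (by linarith)))
    (hi.mono_set (c := 1 / 1000) (d := Real.pi) (by
      rw [Set.uIcc_of_le (by linarith), Set.uIcc_of_le (by linarith)]
      exact Set.Icc_subset_Icc_left (by norm_num)))
  rw [hint] at hsplit
  set D := skewDefect t
  set E := Real.exp (-((digitVar t - 4) / 240000000))
  have hE0 : 0 < E := Real.exp_pos _
  rw [← hs] at hleft hA1
  have hE : 20000 * E ≤ (s ^ 12)⁻¹ / 10 := by
    have h1 : s ^ 12 * E ≤ (s ^ 8) ^ 2 * E := by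
      rw [← pow_mul]
      gcongr
      norm_num
    rw [le_div_iff₀ (by norm_num), ← one_div, le_div_iff₀ (by positivity)]
    linarith
  have hQ : 41600 * (s ^ 3 * D + ((s ^ 3) ^ 2)⁻¹ * s ^ 8) / (s ^ 8) ^ 2 ≤
      (s ^ 12)⁻¹ * (D / 100) := by
    have h1 : 41600 * (s ^ 3 * D + ((s ^ 3) ^ 2)⁻¹ * s ^ 8) / (s ^ 8) ^ 2 =
        (s ^ 12)⁻¹ * (41600 * (D / s + 1 / s ^ 2)) := by
      field_simp
    rw [h1]
    have h2 : D / s ≤ D / 10 ^ 7 := by gcongr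
    have h3 : 1 / s ^ 2 ≤ 1 / 10 ^ 7 := by
      refine one_div_le_one_div_of_le (by norm_num) ?_
      nlinarith
    gcongr
    linarith
  have hmain : D * ((s ^ 4)⁻¹) ^ 3 / 24 = (s ^ 12)⁻¹ * (D / 24) := by
    rw [inv_pow, ← pow_mul]; ring
  have hs12 : 0 < (s ^ 12)⁻¹ := by positivity
  have hfin : 0 < Real.pi * signedTail (charFn t) 0 := by
    rw [← hsplit]
    -- In units of s^(-12) this is D/24 - D/100 - 1/10 > 0, which holds because D ≥ 12.
    nlinarith
  exact pos_of_mul_pos_right hfin Real.pi_pos.le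

end positivity_of_tail

theorem theorem1 :
    ∃ c : ℕ → ℝ,
      (∀ t : ℕ,
        HasAsymptoticDensity {n : ℕ | binaryDigitSum (n + t) ≥ binaryDigitSum n} (c t)) ∧
      ∃ M₀ : ℕ, ∀ t : ℕ, numOneBlocks t ≥ M₀ → c t > 1 / 2 := by
  refine ⟨fun t => (1 + signedTail (charFn t) 0) / 2, fun t => ?_, ?_⟩
  · have h := hasAsymptoticDensity_digitGainSet t 0
    have h2 : digitGainSet t 0 = {n : ℕ | binaryDigitSum (n + t) ≥ binaryDigitSum n} := by
      ext n
      simp [digitGainSet]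
    rwa [h2] at h
  · obtain ⟨A₀, hA₀⟩ := exists_signedTail_charFn_pos
    refine ⟨⌈A₀⌉₊, fun t ht => ?_⟩
    have h1 : A₀ ≤ digitVar t :=
      ((Nat.le_ceil A₀).trans (by exact_mod_cast ht)).trans (numOneBlocks_le_digitVar t)
    have h2 := hA₀ t h1
    simp only [gt_iff_lt]
    linarith
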